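/- Let $\alpha_B,\alpha_E,\lambda_B,\lambda_E,\Delta>0$ and $\mathcal A,\mathcal E\ge 0$ be real numbers such that $$\alpha_B\ge\alpha_E,\qquad \frac{\lambda_B}{\alpha_B}\le\frac{\lambda_E}{\alpha_E},$$ where at least one of the two inequalities is strict. For a real random variable $X\ge 0$, let $Y$ and $Z$ be random variables with values in $\{0,1,2,\dots\}$ such that, conditionally on $X=x$, $Y$ is Poisson distributed with mean $(\alpha_B x+\lambda_B)\Delta$ and $Z$ is Poisson distributed with mean $(\alpha_E x+\lambda_E)\Delta$ (the degraded discrete-time Poisson wiretap channel). Let $\Omega^+_{\mathcal A,\mathcal E}$ be the set of probability distributions $F_X$ of $X$ with $0\le X\le\mathcal A$ almost surely and $\mathbb E[X]\le\mathcal E$. Then for every $F_X\in\Omega^+_{\mathcal A,\mathcal E}$ the mutual informations $I(X;Y)$ and $I(X;Z)$ are finite, the secrecy capacity $$C_S=\sup_{F_X\in\Omega^+_{\mathcal A,\mathcal E}}\bigl[I(X;Y)-I(X;Z)\bigr]$$ is finite, and there is exactly one $F_X^*\in\Omega^+_{\mathcal A,\mathcal E}$ that attains this supremum. Moreover, the support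 of $F_X^*$ is a finite set. -/

import Mathlib

open MeasureTheory ProbabilityTheory InformationTheory
open scoped NNReal ENNReal

namespace PoissonWiretap

/-- The family `r ↦ Poisson(r)` is measurable in the mean. -/
theorem measurable_poissonMeasure : Measurable (poissonMeasure : ℝ≥0 → Measure ℕ) := by
  refine Measure.measurable_of_measurable_coe _ fun s _ => ?_
  have h : (fun r : ℝ≥0 => poissonMeasure r s)
      = fun r : ℝ≥0 => ∑' n : ℕ, s.indicator
          (fun n => ENNReal.ofReal (Real.exp (-(r : ℝ)) * (r : ℝ) ^ n / (n.factorial : ℝ))) n := by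
    funext r
    rw [← Measure.tsum_indicator_apply_singleton _ s (MeasurableSet.of_discrete)]
    refine tsum_congr fun n => ?_
    by_cases hn : n ∈ s <;> simp [hn, poissonMeasure_singleton]
  rw [h]
  refine Measurable.tsum fun n => ?_
  by_cases hn : n ∈ s
  · simp only [hn, Set.indicator_of_mem]
    fun_prop
  · simp [hn]

/-- The discrete-time Poisson channel with gain `α`, dark current `lam` and slot duration `Δ`:
given the input intensity `x`, the output is Poisson distributed with mean `(α x + lam) Δ`.
(The mean is truncated at zero, which is of no effect for nonnegative `x`.) -/
noncomputable def channel (α lam Δ : ℝ) : Kernel ℝ ℕ where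
  toFun x := poissonMeasure (Real.toNNReal ((α * x + lam) * Δ))
  measurable' := measurable_poissonMeasure.comp (by fun_prop)

instance (α lam Δ : ℝ) : IsMarkovKernel (channel α lam Δ) :=
  ⟨fun x => inferInstanceAs (IsProbabilityMeasure
    (poissonMeasure (Real.toNNReal ((α * x + lam) * Δ))))⟩

/-- The mutual information (in nats) between the input, with law `μ`, and the output of the
channel `κ`: the Kullback-Leibler divergence of the joint law from the product of the marginals. -/
noncomputable def mutualInfo {𝓧 𝓨 : Type*} [MeasurableSpace 𝓧] [MeasurableSpace 𝓨]
    (μ : Measure 𝓧) (κ : Kernel 𝓧 𝓨) : ℝ≥0∞ :=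
  klDiv (μ ⊗ₘ κ) (μ.prod (κ ∘ₘ μ))

/-- The input distributions that are supported in `[0, A]` and have mean at most `E`. -/
def feasible (A E : ℝ) : Set (ProbabilityMeasure ℝ) :=
  {μ | (μ : Measure ℝ) (Set.Icc 0 A) = 1 ∧ ∫ x, x ∂(μ : Measure ℝ) ≤ E}

/-- The objective `I(X;Y) - I(X;Z)` as a functional of the law `μ` of `X`, where `Y` and `Z` are
the outputs of the channels `κB` and `κE`. It is meaningful where both terms are finite. -/
noncomputable def secrecyRate (κB κE : Kernel ℝ ℕ) (μ : ProbabilityMeasure ℝ) : ℝ :=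
  (mutualInfo (μ : Measure ℝ) κB).toReal - (mutualInfo (μ : Measure ℝ) κE).toReal

/-- The secrecy capacity: the supremum of `I(X;Y) - I(X;Z)` over the feasible input laws. -/
noncomputable def secrecyCapacity (κB κE : Kernel ℝ ℕ) (A E : ℝ) : ℝ :=
  sSup (secrecyRate κB κE '' feasible A E)

end PoissonWiretap

/-! Put `m x = (αB x + λB) Δ`. The eavesdropper's mean is `p * m x + δ` with `0 < p ≤ 1`, `0 ≤ δ`,
and `p < 1` or `0 < δ`. So `Z` arises from `Y` by keeping each count with probability `p` and adding
an independent Poisson(`δ`) count.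

The central identity is `infoRate_eq`: for any reference law `μ`, the information rate of `ν` is the
`ν`-mean of a density depending on `μ`, minus the relative entropy of the output laws. Subtracting
the two channels (`degradedRate_eq`), the secrecy rate is linear in `ν` minus a gap `D_B - D_E`. By
data processing the gap is nonnegative, and it vanishes only if the legitimate output laws agree
(`mixedRelEntropy_degraded_le`).

Existence: the feasible set is weakly compact and the rate is continuous on it. Uniqueness:
comparing two optimal laws with their midpoint forces both gaps to vanish, so the output laws agree;
a Poisson mixture determines its mixing law through the characteristic function
(`map_eq_of_mixedWeight_eq`).

Finite support: reweight an optimal `μ` by `1 + t h`, with `h` orthogonal to `1` and `x`. The gap is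
`O(t²)`, so the first-order term vanishes and the density is affine on the support
(`exists_affine_of_orthogonal`). If the support were infinite, it would accumulate in `[0, A]`, and
analytic continuation in `r = m x` down to `r = 0` would equate `r log r - (p r + δ) log (p r + δ)`
with a function analytic at `0`. The singularity of `r log r` excludes this
(`finite_of_degradedDensity_eq_affine`). -/

namespace PoissonWiretap

open Real Set Filter Topology

/-! ### Poisson averages of sequences of at most geometric growth -/

/-- The average of the sequence `f` under the Poisson distribution with mean `r`. -/
noncomputable def poissonAverage (f : ℕ → ℝ) (r : ℝ) : ℝ :=
  ∑' k : ℕ, exp (-r) * r ^ k / (k.factorial : ℝ) * f k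

/-- Growth `C * 2 ^ k` is a convenient class: it absorbs the linear growth in `k` of
log-likelihoods, and `k!` still beats it. -/
theorem summable_two_pow_bound (M C : ℝ) :
    Summable fun k : ℕ => M ^ k / (k.factorial : ℝ) * (C * 2 ^ k) := by
  refine ((Real.summable_pow_div_factorial (M * 2)).mul_left C).congr fun k => ?_
  rw [mul_pow]; ring

theorem norm_poisson_term_le {r M C : ℝ} {f : ℕ → ℝ} (hf : ∀ k, |f k| ≤ C * 2 ^ k)
    (hr : 0 ≤ r) (hM : r ≤ M) (k : ℕ) :
    |exp (-r) * r ^ k / (k.factorial : ℝ) * f k| ≤ M ^ k / (k.factorial : ℝ) * (C * 2 ^ k) := by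
  rw [abs_mul, abs_of_nonneg (by positivity : 0 ≤ exp (-r) * r ^ k / (k.factorial : ℝ))]
  have h1 : exp (-r) ≤ 1 := exp_le_one_iff.2 (by linarith)
  have h2 : exp (-r) * r ^ k ≤ M ^ k := by
    calc exp (-r) * r ^ k ≤ 1 * M ^ k := by gcongr
      _ = M ^ k := one_mul _
  have := hr.trans hM
  gcongr
  exact hf k

theorem summable_poissonAverage {r C : ℝ} {f : ℕ → ℝ} (hf : ∀ k, |f k| ≤ C * 2 ^ k)
    (hr : 0 ≤ r) :
    Summable fun k : ℕ => exp (-r) * r ^ k / (k.factorial : ℝ) * f k :=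
  (summable_two_pow_bound r C).of_norm_bounded fun k => norm_poisson_term_le hf hr le_rfl k

/-- The average is `exp (-r)` times a power series of infinite radius. Analyticity at `r = 0`,
outside the range of the intensity, is what the finiteness argument exploits. -/
theorem analyticOnNhd_poissonAverage {C : ℝ} {f : ℕ → ℝ} (hf : ∀ k, |f k| ≤ C * 2 ^ k) :
    AnalyticOnNhd ℝ (poissonAverage f) univ := by
  set c : ℕ → ℝ := fun k => f k / (k.factorial : ℝ)
  have hrad : (FormalMultilinearSeries.ofScalars ℝ c).radius = ⊤ := by
    refine FormalMultilinearSeries.radius_eq_top_of_summable_norm _ fun r => ?_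
    refine (summable_two_pow_bound r C).of_nonneg_of_le (fun k => by positivity) fun k => ?_
    rw [FormalMultilinearSeries.ofScalars_norm]
    simp only [c, norm_div, norm_eq_abs, Nat.abs_cast]
    calc |f k| / (k.factorial : ℝ) * (r : ℝ) ^ k
        ≤ (C * 2 ^ k) / (k.factorial : ℝ) * (r : ℝ) ^ k := by gcongr; exact hf k
      _ = _ := by ring
  have h := (FormalMultilinearSeries.ofScalars ℝ c).hasFPowerSeriesOnBall (by simp [hrad])
  rw [hrad] at h
  have h1 : AnalyticOnNhd ℝ (FormalMultilinearSeries.ofScalars ℝ c).sum univ := by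
    have := h.analyticOnNhd
    simpa using this
  have h2 : poissonAverage f
      = fun r => exp (-r) * (FormalMultilinearSeries.ofScalars ℝ c).sum r := by
    funext r
    rw [show (FormalMultilinearSeries.ofScalars ℝ c).sum r
      = ∑' n, c n • r ^ n from FormalMultilinearSeries.ofScalars_sum_eq c r, ← tsum_mul_left,
      poissonAverage]
    refine tsum_congr fun k => ?_
    simp only [c, smul_eq_mul]; ring
  rw [h2]
  intro r _
  exact (analyticAt_rexp.comp (analyticAt_id.neg)).mul (h1 r (mem_univ _))

theorem hasSum_poisson_one (r : ℝ) :
    HasSum (fun k : ℕ => exp (-r) * r ^ k / (k.factorial : ℝ)) 1 := by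
  have := (NormedSpace.expSeries_div_hasSum_exp (r : ℝ)).mul_left (exp (-r))
  rw [← exp_eq_exp_ℝ, ← exp_add, neg_add_cancel, exp_zero] at this
  simpa only [mul_div_assoc] using this

theorem hasSum_poisson_id (r : ℝ) :
    HasSum (fun k : ℕ => exp (-r) * r ^ k / (k.factorial : ℝ) * k) r := by
  rw [← hasSum_nat_add_iff' 1]
  have := (hasSum_poisson_one r).mul_left r
  simp only [Finset.range_one, Finset.sum_singleton, Nat.cast_zero, mul_zero, sub_zero]
  rw [mul_one] at this
  convert! this using 2 with k
  rw [Nat.factorial_succ]; push_cast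
  have : (k.factorial : ℝ) ≠ 0 := by positivity
  field_simp
  ring

/-! ### Mixed Poisson laws -/

/-- `m` maps `[0, A]` continuously into `[l, M]`, and `l > 0`. -/
structure IsIntensity (m : ℝ → ℝ) (A l M : ℝ) : Prop where
  continuous : Continuous m
  pos : 0 < l
  lower : ∀ x ∈ Icc 0 A, l ≤ m x
  upper : ∀ x ∈ Icc 0 A, m x ≤ M

/-- `k!` times the probability of `k` under the mixture of the laws `Poisson(m x)`, `x ~ μ`. -/
noncomputable def mixedWeight (m : ℝ → ℝ) (μ : Measure ℝ) (k : ℕ) : ℝ :=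
  ∫ x, exp (-m x) * m x ^ k ∂μ

variable {m : ℝ → ℝ} {A l M : ℝ} {μ ν : Measure ℝ}

theorem restrict_Icc_eq (hμ : ∀ᵐ x ∂μ, x ∈ Icc 0 A) : μ.restrict (Icc 0 A) = μ :=
  Measure.restrict_eq_self_of_ae_mem hμ

theorem integrable_of_continuousOn_Icc [IsFiniteMeasure μ] (hμ : ∀ᵐ x ∂μ, x ∈ Icc 0 A)
    {φ : ℝ → ℝ} (hφ : ContinuousOn φ (Icc 0 A)) : Integrable φ μ := by
  have := hφ.integrableOn_compact (μ := μ) isCompact_Icc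
  rwa [IntegrableOn, restrict_Icc_eq hμ] at this

namespace IsIntensity

theorem le_of_nonempty [IsProbabilityMeasure μ] (hm : IsIntensity m A l M)
    (hμ : ∀ᵐ x ∂μ, x ∈ Icc 0 A) : l ≤ M := by
  obtain ⟨x, hx⟩ := hμ.exists
  exact (hm.lower x hx).trans (hm.upper x hx)

theorem integrable_weight [IsFiniteMeasure μ] (hm : IsIntensity m A l M)
    (hμ : ∀ᵐ x ∂μ, x ∈ Icc 0 A) (k : ℕ) : Integrable (fun x => exp (-m x) * m x ^ k) μ := by
  have := hm.continuous
  exact integrable_of_continuousOn_Icc hμ (by fun_prop)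

theorem le_weight (hm : IsIntensity m A l M) (k : ℕ) {x : ℝ} (hx : x ∈ Icc 0 A) :
    exp (-M) * l ^ k ≤ exp (-m x) * m x ^ k := by
  have h1 := hm.lower x hx
  have h2 := hm.upper x hx
  have := hm.pos
  gcongr

theorem weight_le (hm : IsIntensity m A l M) (k : ℕ) {x : ℝ} (hx : x ∈ Icc 0 A) :
    exp (-m x) * m x ^ k ≤ M ^ k := by
  have h1 := hm.lower x hx
  have h2 := hm.upper x hx
  have h3 := hm.pos
  have : exp (-m x) ≤ 1 := exp_le_one_iff.2 (by linarith)
  have h4 : 0 ≤ m x := by linarith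
  calc exp (-m x) * m x ^ k ≤ 1 * M ^ k := by gcongr
    _ = M ^ k := one_mul _

theorem le_mixedWeight [IsProbabilityMeasure μ] (hm : IsIntensity m A l M)
    (hμ : ∀ᵐ x ∂μ, x ∈ Icc 0 A) (k : ℕ) : exp (-M) * l ^ k ≤ mixedWeight m μ k := by
  have := integral_mono_ae (integrable_const (exp (-M) * l ^ k)) (hm.integrable_weight hμ k)
    (hμ.mono fun x hx => hm.le_weight k hx)
  simpa [mixedWeight] using this

theorem mixedWeight_le [IsProbabilityMeasure μ] (hm : IsIntensity m A l M)
    (hμ : ∀ᵐ x ∂μ, x ∈ Icc 0 A) (k : ℕ) : mixedWeight m μ k ≤ M ^ k := by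
  have := integral_mono_ae (hm.integrable_weight hμ k) (integrable_const (M ^ k))
    (hμ.mono fun x hx => hm.weight_le k hx)
  simpa [mixedWeight] using this

theorem mixedWeight_pos [IsProbabilityMeasure μ] (hm : IsIntensity m A l M)
    (hμ : ∀ᵐ x ∂μ, x ∈ Icc 0 A) (k : ℕ) : 0 < mixedWeight m μ k := by
  have := hm.pos
  exact lt_of_lt_of_le (by positivity) (hm.le_mixedWeight hμ k)

/-- The weight lies between `exp (-M) * l ^ k` and `M ^ k`, so its logarithm is at most linear in
`k`; this needs the dark current, `l > 0`. The bound is uniform in `μ`, which later gives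
continuity. -/
theorem abs_log_mixedWeight_le [IsProbabilityMeasure μ] (hm : IsIntensity m A l M)
    (hμ : ∀ᵐ x ∂μ, x ∈ Icc 0 A) (k : ℕ) :
    |log (mixedWeight m μ k)| ≤ (M + |log l| + |log M|) * 2 ^ k := by
  have hl := hm.pos
  have hM : 0 < M := hl.trans_le (hm.le_of_nonempty hμ)
  have h1 := log_le_log (by positivity) (hm.le_mixedWeight hμ k)
  have h2 := log_le_log (hm.mixedWeight_pos hμ k) (hm.mixedWeight_le hμ k)
  rw [log_mul (by positivity) (by positivity), log_exp, log_pow] at h1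
  rw [log_pow] at h2
  have hk : (k : ℝ) ≤ 2 ^ k := by exact_mod_cast Nat.lt_two_pow_self.le
  have hk1 : (1 : ℝ) ≤ 2 ^ k := one_le_pow₀ (by norm_num)
  have a1 : (k : ℝ) * |log l| ≤ 2 ^ k * |log l| := by gcongr
  have a2 : (k : ℝ) * |log M| ≤ 2 ^ k * |log M| := by gcongr
  have a3 : -(k * |log l|) ≤ k * log l := by
    rw [← mul_neg]; exact mul_le_mul_of_nonneg_left (neg_abs_le _) (by positivity)
  have a4 : k * log M ≤ k * |log M| := mul_le_mul_of_nonneg_left (le_abs_self _) (by positivity)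
  have a5 : M ≤ 2 ^ k * M := le_mul_of_one_le_left hM.le hk1
  have b1 : 0 ≤ (2 : ℝ) ^ k * |log l| := by positivity
  have b2 : 0 ≤ (2 : ℝ) ^ k * |log M| := by positivity
  rw [abs_le]
  constructor <;> nlinarith

theorem hasSum_mixedWeight_mul [IsProbabilityMeasure μ] (hm : IsIntensity m A l M)
    (hμ : ∀ᵐ x ∂μ, x ∈ Icc 0 A) {C : ℝ} {f : ℕ → ℝ} (hf : ∀ k, |f k| ≤ C * 2 ^ k) :
    HasSum (fun k : ℕ => mixedWeight m μ k / (k.factorial : ℝ) * f k)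
      (∫ x, poissonAverage f (m x) ∂μ) := by
  have hint : ∀ k : ℕ, Integrable
      (fun x => exp (-m x) * m x ^ k / (k.factorial : ℝ) * f k) μ := fun k =>
    ((hm.integrable_weight hμ k).div_const _).mul_const _
  have := hasSum_integral_of_summable_integral_norm (μ := μ)
    (F := fun (k : ℕ) x => exp (-m x) * m x ^ k / (k.factorial : ℝ) * f k) hint ?_
  · convert! this using 2 with k
    rw [integral_mul_const, integral_div, mixedWeight]
  · refine (summable_two_pow_bound M C).of_nonneg_of_le (fun k => by positivity) fun k => ?_
    have := integral_mono_ae (hint k).norm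
      (integrable_const (M ^ k / (k.factorial : ℝ) * (C * 2 ^ k)))
      (hμ.mono fun x hx => norm_poisson_term_le hf
        (hm.pos.le.trans (hm.lower x hx)) (hm.upper x hx) k)
    simpa using this

theorem hasSum_mixedWeight [IsProbabilityMeasure μ] (hm : IsIntensity m A l M)
    (hμ : ∀ᵐ x ∂μ, x ∈ Icc 0 A) :
    HasSum (fun k : ℕ => mixedWeight m μ k / (k.factorial : ℝ)) 1 := by
  have h := hm.hasSum_mixedWeight_mul hμ (C := 1) (f := fun _ => 1)
    (fun k => by simpa using one_le_pow₀ (one_le_two))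
  have h1 : ∀ r, poissonAverage (fun _ => 1) r = 1 := fun r => by
    simpa [poissonAverage] using (hasSum_poisson_one r).tsum_eq
  simpa [h1] using h

end IsIntensity

end PoissonWiretap

namespace PoissonWiretap

open Real Set Filter Topology

/-! ### Information rates of mixed Poisson channels -/

variable {m : ℝ → ℝ} {A l M : ℝ} {μ ν : Measure ℝ}

/-- The mutual information between `x ~ μ` and a Poisson variable with mean `m x`. -/
noncomputable def infoRate (m : ℝ → ℝ) (μ : Measure ℝ) : ℝ :=
  ∫ x, (m x * log (m x) - m x) ∂μ
    - ∑' k : ℕ, mixedWeight m μ k / (k.factorial : ℝ) * log (mixedWeight m μ k)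

/-- The relative entropy of `Poisson(m x)` with respect to the mixture with mixing law `μ`. -/
noncomputable def infoDensity (m : ℝ → ℝ) (μ : Measure ℝ) (x : ℝ) : ℝ :=
  m x * log (m x) - m x - poissonAverage (fun k => log (mixedWeight m μ k)) (m x)

/-- The relative entropy between the mixed Poisson laws with mixing laws `ν` and `μ`. -/
noncomputable def mixedRelEntropy (m : ℝ → ℝ) (ν μ : Measure ℝ) : ℝ :=
  ∑' k : ℕ, mixedWeight m ν k / (k.factorial : ℝ)
    * (log (mixedWeight m ν k) - log (mixedWeight m μ k))

namespace IsIntensity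

theorem summable_mixedWeight_mul_log [IsProbabilityMeasure μ] [IsProbabilityMeasure ν]
    (hm : IsIntensity m A l M) (hμ : ∀ᵐ x ∂μ, x ∈ Icc 0 A) (hν : ∀ᵐ x ∂ν, x ∈ Icc 0 A) :
    Summable fun k : ℕ => mixedWeight m ν k / (k.factorial : ℝ) * log (mixedWeight m μ k) :=
  (hm.hasSum_mixedWeight_mul hν (hm.abs_log_mixedWeight_le hμ)).summable

theorem summable_mixedRelEntropy [IsProbabilityMeasure μ] [IsProbabilityMeasure ν]
    (hm : IsIntensity m A l M) (hμ : ∀ᵐ x ∂μ, x ∈ Icc 0 A) (hν : ∀ᵐ x ∂ν, x ∈ Icc 0 A) :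
    Summable fun k : ℕ => mixedWeight m ν k / (k.factorial : ℝ)
      * (log (mixedWeight m ν k) - log (mixedWeight m μ k)) := by
  simpa only [mul_sub] using
    (hm.summable_mixedWeight_mul_log hν hν).sub (hm.summable_mixedWeight_mul_log hμ hν)

theorem continuous_poissonAverage_log [IsProbabilityMeasure μ] (hm : IsIntensity m A l M)
    (hμ : ∀ᵐ x ∂μ, x ∈ Icc 0 A) :
    Continuous fun x => poissonAverage (fun k => log (mixedWeight m μ k)) (m x) := by
  have h := (analyticOnNhd_poissonAverage (hm.abs_log_mixedWeight_le hμ)).continuousOn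
  exact (continuousOn_univ.1 h).comp hm.continuous

theorem continuous_mul_log_sub (hm : IsIntensity m A l M) :
    Continuous fun x => m x * log (m x) - m x :=
  (Real.continuous_mul_log.comp hm.continuous).sub hm.continuous

theorem continuous_infoDensity [IsProbabilityMeasure μ] (hm : IsIntensity m A l M)
    (hμ : ∀ᵐ x ∂μ, x ∈ Icc 0 A) : Continuous (infoDensity m μ) :=
  hm.continuous_mul_log_sub.sub (hm.continuous_poissonAverage_log hμ)

/-- The compensation identity: replacing the true output law by that of `μ` inside the logarithm
costs exactly a relative entropy. -/
theorem infoRate_eq [IsProbabilityMeasure μ] [IsProbabilityMeasure ν]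
    (hm : IsIntensity m A l M) (hμ : ∀ᵐ x ∂μ, x ∈ Icc 0 A) (hν : ∀ᵐ x ∂ν, x ∈ Icc 0 A) :
    infoRate m ν = ∫ x, infoDensity m μ x ∂ν - mixedRelEntropy m ν μ := by
  have h1 := (hm.hasSum_mixedWeight_mul hν (hm.abs_log_mixedWeight_le hμ)).tsum_eq
  have h2 : mixedRelEntropy m ν μ
      = ∑' k : ℕ, mixedWeight m ν k / (k.factorial : ℝ) * log (mixedWeight m ν k)
        - ∫ x, poissonAverage (fun k => log (mixedWeight m μ k)) (m x) ∂ν := by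
    rw [← h1, mixedRelEntropy, ← (hm.summable_mixedWeight_mul_log hν hν).tsum_sub
      (hm.summable_mixedWeight_mul_log hμ hν)]
    simp only [mul_sub]
  rw [h2]
  simp only [infoDensity]
  rw [integral_sub (integrable_of_continuousOn_Icc hν hm.continuous_mul_log_sub.continuousOn)
    (integrable_of_continuousOn_Icc hν (hm.continuous_poissonAverage_log hμ).continuousOn),
    infoRate]
  ring

theorem mixedRelEntropy_self (m : ℝ → ℝ) (μ : Measure ℝ) : mixedRelEntropy m μ μ = 0 := by
  simp [mixedRelEntropy]

theorem mixedRelEntropy_nonneg [IsProbabilityMeasure μ] [IsProbabilityMeasure ν]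
    (hm : IsIntensity m A l M) (hμ : ∀ᵐ x ∂μ, x ∈ Icc 0 A) (hν : ∀ᵐ x ∂ν, x ∈ Icc 0 A) :
    0 ≤ mixedRelEntropy m ν μ := by
  have h := (hm.hasSum_mixedWeight hν).sub (hm.hasSum_mixedWeight hμ)
  rw [sub_self] at h
  rw [← h.tsum_eq]
  refine h.summable.tsum_le_tsum (fun k => ?_) (hm.summable_mixedRelEntropy hμ hν)
  have p := hm.mixedWeight_pos hν k
  have q := hm.mixedWeight_pos hμ k
  rw [← sub_div, div_mul_eq_mul_div]
  gcongr
  have := one_sub_inv_le_log_of_pos (div_pos p q)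
  rw [log_div p.ne' q.ne', inv_div] at this
  calc mixedWeight m ν k - mixedWeight m μ k
      = mixedWeight m ν k * (1 - mixedWeight m μ k / mixedWeight m ν k) := by field_simp
    _ ≤ _ := by gcongr

/-- A chi-square bound from `log x ≤ x - 1`: relative entropy is of second order in the relative
perturbation. -/
theorem mixedRelEntropy_le_sq [IsProbabilityMeasure μ] [IsProbabilityMeasure ν]
    (hm : IsIntensity m A l M) (hμ : ∀ᵐ x ∂μ, x ∈ Icc 0 A) (hν : ∀ᵐ x ∂ν, x ∈ Icc 0 A)
    {ε : ℝ} (h : ∀ k, |mixedWeight m ν k - mixedWeight m μ k| ≤ ε * mixedWeight m μ k) :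
    mixedRelEntropy m ν μ ≤ ε ^ 2 := by
  -- Adding the difference of the two mass functions, of total sum zero, makes the comparison hold
  -- term by term.
  have h1 := ((hm.hasSum_mixedWeight hμ).mul_left (ε ^ 2)).add
    ((hm.hasSum_mixedWeight hν).sub (hm.hasSum_mixedWeight hμ))
  rw [sub_self, add_zero, mul_one] at h1
  rw [← h1.tsum_eq]
  refine (hm.summable_mixedRelEntropy hμ hν).tsum_le_tsum (fun k => ?_) h1.summable
  have p := hm.mixedWeight_pos hν k
  have q := hm.mixedWeight_pos hμ k
  have hk := h k
  set a := mixedWeight m ν k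
  set b := mixedWeight m μ k
  rw [← sub_div, div_mul_eq_mul_div, ← mul_div_assoc, ← add_div]
  gcongr
  have h2 := log_le_sub_one_of_pos (div_pos p q)
  rw [log_div p.ne' q.ne'] at h2
  have h3 : (a - b) ^ 2 ≤ (ε * b) ^ 2 := sq_le_sq' (by linarith [(abs_le.1 hk).1]) (abs_le.1 hk).2
  calc a * (log a - log b) ≤ a * (a / b - 1) := by gcongr
    _ = (a - b) ^ 2 / b + (a - b) := by field_simp; ring
    _ ≤ (ε * b) ^ 2 / b + (a - b) := by gcongr
    _ = ε ^ 2 * b + (a - b) := by field_simp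

end IsIntensity

/-! ### Strict data processing for discrete channels -/

/-- The expression equals `w * b * v * klFun (a / b / v)`, and `klFun` is nonnegative on `[0, ∞)`
with its only zero at `1`. -/
theorem mul_log_div_gap {a b v w : ℝ} (hw : 0 ≤ w) (ha : 0 < a) (hb : 0 < b) (hv : 0 < v) :
    0 ≤ a * w * log (a / b) - a * w * log v - a * w + b * w * v ∧
      (a * w * log (a / b) - a * w * log v - a * w + b * w * v = 0 → w = 0 ∨ a / b = v) := by
  have key : a * w * log (a / b) - a * w * log v - a * w + b * w * v
      = w * (b * v * klFun (a / b / v)) := by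
    rw [klFun_apply, log_div (div_pos ha hb).ne' hv.ne']
    field_simp
    ring
  rw [key]
  have h0 : 0 ≤ a / b / v := by positivity
  refine ⟨mul_nonneg hw (mul_nonneg (by positivity) (klFun_nonneg h0)), fun h => ?_⟩
  rcases mul_eq_zero.1 h with h | h
  · exact Or.inl h
  · right
    rcases mul_eq_zero.1 h with h | h
    · exact absurd h (by positivity)
    · have := (klFun_eq_zero_iff h0).1 h
      rwa [div_eq_one_iff_eq hv.ne'] at this

/-- Data processing for a stochastic matrix `W`, with the equality case when any two consecutive
inputs share an output. -/
theorem relEntropy_le_of_stochastic {a b a' b' : ℕ → ℝ} {W : ℕ → ℕ → ℝ}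
    (ha : ∀ k, 0 < a k) (hb : ∀ k, 0 < b k) (ha' : ∀ k, 0 < a' k) (hb' : ∀ k, 0 < b' k)
    (ha1 : HasSum a 1) (hb1 : HasSum b 1)
    (hW0 : ∀ k j, 0 ≤ W k j) (hW1 : ∀ k, HasSum (W k) 1)
    (haW : ∀ j, HasSum (fun k => a k * W k j) (a' j))
    (hbW : ∀ j, HasSum (fun k => b k * W k j) (b' j))
    (hs : Summable fun k => a k * log (a k / b k))
    (hs' : Summable fun j => a' j * log (a' j / b' j)) :
    ∑' j, a' j * log (a' j / b' j) ≤ ∑' k, a k * log (a k / b k) ∧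
      (∑' j, a' j * log (a' j / b' j) = ∑' k, a k * log (a k / b k) →
        (∀ k, ∃ j, 0 < W k j ∧ 0 < W (k + 1) j) → a = b) := by
  have hsum : Summable fun q : ℕ × ℕ => a q.1 * W q.1 q.2 * log (a q.1 / b q.1) := by
    rw [← summable_abs_iff, summable_prod_of_nonneg fun _ => abs_nonneg _]
    have e : ∀ k j, |a k * W k j * log (a k / b k)| = |a k * log (a k / b k)| * W k j :=
      fun k j => by rw [mul_right_comm, abs_mul, abs_of_nonneg (hW0 k j)]
    simp only [e]
    refine ⟨fun k => (hW1 k).summable.mul_left _, ?_⟩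
    simp only [tsum_mul_left, (hW1 _).tsum_eq, mul_one]
    exact hs.abs
  have hswap : HasSum (fun q : ℕ × ℕ => a q.2 * W q.2 q.1 * log (a q.2 / b q.2))
      (∑' k, a k * log (a k / b k)) := by
    have h1 : HasSum (fun q : ℕ × ℕ => a q.1 * W q.1 q.2 * log (a q.1 / b q.1))
        (∑' k, a k * log (a k / b k)) := by
      have := hsum.hasSum
      rw [hsum.tsum_prod] at this
      convert! this using 3 with k
      have : ∀ j, a k * W k j * log (a k / b k) = a k * log (a k / b k) * W k j := fun j => by ring
      simp only [this, tsum_mul_left, (hW1 k).tsum_eq, mul_one]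
    exact (Equiv.prodComm ℕ ℕ).hasSum_iff.2 h1
  have hrow : ∀ j, Summable fun k => a k * W k j * log (a k / b k) := fun j =>
    hswap.summable.prod_factor j
  set T : ℕ → ℝ := fun j => ∑' k, a k * W k j * log (a k / b k)
  have hT : HasSum T (∑' k, a k * log (a k / b k)) :=
    hswap.prod_fiberwise fun j => (hrow j).hasSum
  have hv : ∀ j, 0 < a' j / b' j := fun j => div_pos (ha' j) (hb' j)
  -- Log-sum inequality with its defect: for output `j` the linear terms cancel in total, since `b'
  -- j * (a' j / b' j) = a' j`.
  have hgap : ∀ j, HasSum (fun k => a k * W k j * log (a k / b k)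
      - a k * W k j * log (a' j / b' j) - a k * W k j + b k * W k j * (a' j / b' j))
      (T j - a' j * log (a' j / b' j)) := fun j => by
    have := ((((hrow j).hasSum).sub ((haW j).mul_right (log (a' j / b' j)))).sub (haW j)).add
      ((hbW j).mul_right (a' j / b' j))
    rw [mul_div_cancel₀ _ (hb' j).ne', sub_add_cancel] at this
    exact this
  have hle : ∀ j, a' j * log (a' j / b' j) ≤ T j := fun j =>
    sub_nonneg.1 ((hgap j).nonneg fun k =>
      (mul_log_div_gap (hW0 k j) (ha k) (hb k) (hv j)).1)
  refine ⟨hT.tsum_eq ▸ hs'.tsum_le_tsum hle hT.summable, fun heq hconn => ?_⟩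
  have hTeq : ∀ j, T j - a' j * log (a' j / b' j) = 0 := by
    have h0 := hT.sub hs'.hasSum
    rw [heq, sub_self] at h0
    exact fun j => congrFun ((hasSum_zero_iff_of_nonneg fun j => sub_nonneg.2 (hle j)).1 h0) j
  -- Zero defect makes the likelihood ratio equal on all inputs reaching `j`. Shared outputs then
  -- carry it from `k` to `k + 1`, and normalisation makes the constant `1`.
  have hratio : ∀ k j, 0 < W k j → a k / b k = a' j / b' j := fun k j hkj => by
    have h0 := hgap j
    rw [hTeq j] at h0
    have := congrFun ((hasSum_zero_iff_of_nonneg fun k =>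
      (mul_log_div_gap (hW0 k j) (ha k) (hb k) (hv j)).1).1 h0) k
    exact ((mul_log_div_gap (hW0 k j) (ha k) (hb k) (hv j)).2 this).resolve_left hkj.ne'
  have hstep : ∀ k, a (k + 1) / b (k + 1) = a k / b k := fun k => by
    obtain ⟨j, h1, h2⟩ := hconn k
    rw [hratio _ j h1, hratio _ j h2]
  have hconst : ∀ k, a k = a 0 / b 0 * b k := fun k => by
    rw [← div_eq_iff (hb k).ne']
    induction k with
    | zero => rfl
    | succ k ih => rw [hstep, ih]
  have h1 := hb1.mul_left (a 0 / b 0)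
  rw [mul_one, ← funext hconst] at h1
  have h2 := ha1.unique h1
  funext k
  rw [hconst k, ← h2, one_mul]

end PoissonWiretap

namespace PoissonWiretap

open Real Set Filter Topology

/-! ### Thinning and adding dark counts -/

/-- The probability of output `j` given input `k`, when the `k` input counts are kept independently
with probability `p` and an independent `Poisson(δ)` number of counts is added. -/
noncomputable def degradation (p δ : ℝ) (k j : ℕ) : ℝ :=
  ∑ q ∈ Finset.HasAntidiagonal.antidiagonal j, (k.choose q.1 * p ^ q.1 * (1 - p) ^ (k - q.1))
    * (exp (-δ) * δ ^ q.2 / (q.2.factorial : ℝ))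

/-- After the vanishing terms `k < i` are removed, the sum factors as the mass at `i` of mean `p *
r` times the total mass of the deleted counts, of mean `(1 - p) * r`. -/
theorem hasSum_poisson_thinning (r p : ℝ) (i : ℕ) :
    HasSum (fun k : ℕ => exp (-r) * r ^ k / (k.factorial : ℝ)
      * (k.choose i * p ^ i * (1 - p) ^ (k - i)))
      (exp (-(p * r)) * (p * r) ^ i / (i.factorial : ℝ)) := by
  rw [← hasSum_nat_add_iff' i, Finset.sum_eq_zero, sub_zero]
  · have h := (hasSum_poisson_one ((1 - p) * r)).mul_left
      (exp (-(p * r)) * (p * r) ^ i / (i.factorial : ℝ))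
    rw [mul_one] at h
    convert! h using 2 with n
    have h1 : exp (-r) = exp (-(p * r)) * exp (-((1 - p) * r)) := by
      rw [← exp_add]; congr 1; ring
    have h2 := Nat.add_choose_mul_factorial_mul_factorial n i
    have h3 : ((n + i).choose i : ℝ) = ((n + i).factorial : ℝ) / (i.factorial * n.factorial) := by
      rw [eq_div_iff (by positivity), ← h2]; push_cast; ring
    rw [h3, h1, Nat.add_sub_cancel, mul_pow, mul_pow, pow_add]
    have : ((n + i).factorial : ℝ) ≠ 0 := by positivity
    field_simp
  · intro k hk
    rw [Nat.choose_eq_zero_of_lt (Finset.mem_range.1 hk)]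
    simp

theorem poisson_add (a b : ℝ) (j : ℕ) :
    ∑ q ∈ Finset.HasAntidiagonal.antidiagonal j, (exp (-a) * a ^ q.1 / (q.1.factorial : ℝ))
      * (exp (-b) * b ^ q.2 / (q.2.factorial : ℝ))
      = exp (-(a + b)) * (a + b) ^ j / (j.factorial : ℝ) := by
  rw [(Commute.all a b).add_pow', Finset.mul_sum, Finset.sum_div]
  refine Finset.sum_congr rfl fun q hq => ?_
  have h1 : q.1 + q.2 = j := Finset.HasAntidiagonal.mem_antidiagonal.1 hq
  have h2 := Nat.add_choose_mul_factorial_mul_factorial q.2 q.1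
  rw [add_comm, h1] at h2
  have h3 : (j.choose q.1 : ℝ) = (j.factorial : ℝ) / (q.1.factorial * q.2.factorial) := by
    rw [eq_div_iff (by positivity), ← h2]; push_cast; ring
  have : (j.factorial : ℝ) ≠ 0 := by positivity
  rw [nsmul_eq_mul, h3, neg_add, exp_add]
  field_simp

theorem hasSum_poisson_degradation (r p δ : ℝ) (j : ℕ) :
    HasSum (fun k : ℕ => exp (-r) * r ^ k / (k.factorial : ℝ) * degradation p δ k j)
      (exp (-(p * r + δ)) * (p * r + δ) ^ j / (j.factorial : ℝ)) := by
  rw [← poisson_add]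
  have := hasSum_sum (s := Finset.HasAntidiagonal.antidiagonal j) fun q _ =>
    (hasSum_poisson_thinning r p q.1).mul_right (exp (-δ) * δ ^ q.2 / (q.2.factorial : ℝ))
  convert! this using 2 with k
  rw [degradation, Finset.mul_sum]
  exact Finset.sum_congr rfl fun q _ => by ring

theorem degradation_nonneg {p δ : ℝ} (hp0 : 0 ≤ p) (hp1 : p ≤ 1) (hδ : 0 ≤ δ) (k j : ℕ) :
    0 ≤ degradation p δ k j := by
  have := sub_nonneg.2 hp1
  exact Finset.sum_nonneg fun q _ => by positivity

theorem hasSum_binomial (p : ℝ) (k : ℕ) :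
    HasSum (fun i : ℕ => k.choose i * p ^ i * (1 - p) ^ (k - i)) 1 := by
  have h : HasSum (fun i : ℕ => k.choose i * p ^ i * (1 - p) ^ (k - i))
      (∑ i ∈ Finset.range (k + 1), k.choose i * p ^ i * (1 - p) ^ (k - i)) :=
    hasSum_sum_of_ne_finset_zero fun i hi => by
      rw [Nat.choose_eq_zero_of_lt (by simpa [Nat.lt_succ_iff] using hi)]; simp
  convert! h using 1
  have := add_pow p (1 - p) k
  rw [add_sub_cancel, one_pow] at this
  exact this.trans (Finset.sum_congr rfl fun i _ => by ring)

theorem hasSum_antidiagonal_mul {f g : ℕ → ℝ} {a b : ℝ} (hf : HasSum f a) (hg : HasSum g b) :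
    HasSum (fun n => ∑ q ∈ Finset.HasAntidiagonal.antidiagonal n, f q.1 * g q.2) (a * b) := by
  have hprod := summable_mul_of_summable_norm hf.summable.norm hg.summable.norm
  have he := hf.summable.tsum_mul_tsum_eq_tsum_sum_antidiagonal hg.summable hprod
  rw [hf.tsum_eq, hg.tsum_eq] at he
  rw [he]
  exact (summable_sum_mul_antidiagonal_of_summable_mul hprod).hasSum

theorem hasSum_degradation (p δ : ℝ) (k : ℕ) : HasSum (degradation p δ k) 1 := by
  have h := hasSum_antidiagonal_mul (hasSum_binomial p k) (hasSum_poisson_one δ)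
  rw [one_mul] at h
  exact h

/-- If `δ = 0` then `p < 1` and every count may be lost, so output `0` is shared. If `δ > 0`, output
`k + 1` is shared: keep all `k` counts and add one, or keep all `k + 1` and add none. -/
theorem degradation_connected {p δ : ℝ} (hp0 : 0 < p) (hp1 : p ≤ 1) (hδ : 0 ≤ δ)
    (h : p < 1 ∨ 0 < δ) (k : ℕ) :
    ∃ j, 0 < degradation p δ k j ∧ 0 < degradation p δ (k + 1) j := by
  have hp := sub_nonneg.2 hp1
  rcases hδ.eq_or_lt with rfl | hδ
  · have hp1 : 0 < 1 - p := sub_pos.2 (h.resolve_right (lt_irrefl _))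
    exact ⟨0, by simp [degradation, hp1], by simp only [degradation]; simp; positivity⟩
  · refine ⟨k + 1, ?_, ?_⟩
    · refine Finset.sum_pos' (fun q _ => by positivity) ⟨(k, 1), by simp, ?_⟩
      simp only [Nat.choose_self, Nat.sub_self]; positivity
    · refine Finset.sum_pos' (fun q _ => by positivity) ⟨(k + 1, 0), by simp, ?_⟩
      simp only [Nat.choose_self, Nat.sub_self]; positivity

variable {m : ℝ → ℝ} {A l M : ℝ} {μ ν : Measure ℝ}

namespace IsIntensity

theorem hasSum_mixedWeight_degradation [IsProbabilityMeasure μ] (hm : IsIntensity m A l M)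
    (hμ : ∀ᵐ x ∂μ, x ∈ Icc 0 A) {p δ : ℝ} (hp0 : 0 ≤ p) (hp1 : p ≤ 1) (hδ : 0 ≤ δ) (j : ℕ) :
    HasSum (fun k : ℕ => mixedWeight m μ k / (k.factorial : ℝ) * degradation p δ k j)
      (mixedWeight (fun x => p * m x + δ) μ j / (j.factorial : ℝ)) := by
  have h := hm.hasSum_mixedWeight_mul hμ (C := 1) (f := fun k => degradation p δ k j) fun k => by
    rw [abs_of_nonneg (degradation_nonneg hp0 hp1 hδ k j), one_mul]
    exact (le_hasSum (hasSum_degradation p δ k) j fun i _ =>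
      degradation_nonneg hp0 hp1 hδ k i).trans (one_le_pow₀ one_le_two)
  convert! h using 1
  rw [mixedWeight, ← integral_div]
  exact integral_congr_ae (.of_forall fun x => (hasSum_poisson_degradation (m x) p δ j).tsum_eq.symm)

theorem mixedRelEntropy_degraded_le {p δ l' M' : ℝ} [IsProbabilityMeasure μ]
    [IsProbabilityMeasure ν] (hm : IsIntensity m A l M)
    (hm' : IsIntensity (fun x => p * m x + δ) A l' M')
    (hμ : ∀ᵐ x ∂μ, x ∈ Icc 0 A) (hν : ∀ᵐ x ∂ν, x ∈ Icc 0 A)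
    (hp0 : 0 < p) (hp1 : p ≤ 1) (hδ : 0 ≤ δ) (h : p < 1 ∨ 0 < δ) :
    mixedRelEntropy (fun x => p * m x + δ) ν μ ≤ mixedRelEntropy m ν μ ∧
      (mixedRelEntropy (fun x => p * m x + δ) ν μ = mixedRelEntropy m ν μ →
        mixedWeight m ν = mixedWeight m μ) := by
  -- The factorials cancel in likelihood ratios, so weights may be exchanged for probabilities.
  have elog : ∀ {m : ℝ → ℝ} {l M : ℝ}, IsIntensity m A l M → ∀ k : ℕ,
      mixedWeight m ν k / (k.factorial : ℝ) * (log (mixedWeight m ν k) - log (mixedWeight m μ k))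
        = mixedWeight m ν k / (k.factorial : ℝ) * log ((mixedWeight m ν k / (k.factorial : ℝ))
          / (mixedWeight m μ k / (k.factorial : ℝ))) := fun hm k => by
    rw [div_div_div_cancel_right₀ (by positivity),
      log_div (hm.mixedWeight_pos hν k).ne' (hm.mixedWeight_pos hμ k).ne']
  have hpos : ∀ {m : ℝ → ℝ} {l M : ℝ}, IsIntensity m A l M → ∀ k : ℕ,
      0 < mixedWeight m ν k / (k.factorial : ℝ) ∧ 0 < mixedWeight m μ k / (k.factorial : ℝ) :=
    fun hm k => ⟨div_pos (hm.mixedWeight_pos hν k) (by positivity),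
      div_pos (hm.mixedWeight_pos hμ k) (by positivity)⟩
  have key := relEntropy_le_of_stochastic (fun k => (hpos hm k).1) (fun k => (hpos hm k).2)
    (fun k => (hpos hm' k).1) (fun k => (hpos hm' k).2)
    (hm.hasSum_mixedWeight hν) (hm.hasSum_mixedWeight hμ)
    (degradation_nonneg hp0.le hp1 hδ) (hasSum_degradation p δ)
    (hm.hasSum_mixedWeight_degradation hν hp0.le hp1 hδ)
    (hm.hasSum_mixedWeight_degradation hμ hp0.le hp1 hδ)
    ((hm.summable_mixedRelEntropy hμ hν).congr (elog hm))
    ((hm'.summable_mixedRelEntropy hμ hν).congr (elog hm'))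
  rw [← tsum_congr (elog hm), ← tsum_congr (elog hm')] at key
  refine ⟨key.1, fun he => ?_⟩
  have := key.2 he (degradation_connected hp0 hp1 hδ h)
  funext k
  have hk := congrFun this k
  rwa [div_left_inj' (by positivity)] at hk

/-! ### Identifiability of the mixing law -/

/-- Write `exp (i t m) = exp (-m) * exp (m (1 + i t))` and expand the second factor: the
characteristic function of `m x` depends on `μ` only through the weights. -/
theorem integral_cexp_eq_tsum [IsProbabilityMeasure μ] (hm : IsIntensity m A l M)
    (hμ : ∀ᵐ x ∂μ, x ∈ Icc 0 A) (t : ℝ) :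
    ∫ x, Complex.exp (t * m x * Complex.I) ∂μ
      = ∑' k : ℕ, (mixedWeight m μ k : ℂ) * ((1 + t * Complex.I) ^ k / (k.factorial : ℂ)) := by
  set z : ℂ := 1 + t * Complex.I
  have hint : ∀ k : ℕ, Integrable
      (fun x => ((exp (-m x) * m x ^ k : ℝ) : ℂ) * (z ^ k / (k.factorial : ℂ))) μ := fun k =>
    (hm.integrable_weight hμ k).ofReal.mul_const _
  have h := hasSum_integral_of_summable_integral_norm (μ := μ) hint ?_
  · have e1 : ∀ k : ℕ, ∫ x, ((exp (-m x) * m x ^ k : ℝ) : ℂ) * (z ^ k / (k.factorial : ℂ)) ∂μ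
        = (mixedWeight m μ k : ℂ) * (z ^ k / (k.factorial : ℂ)) := fun k => by
      rw [integral_mul_const, integral_complex_ofReal, mixedWeight]
    simp only [e1] at h
    rw [h.tsum_eq]
    refine integral_congr_ae (.of_forall fun x => ?_)
    have h2 := (NormedSpace.expSeries_div_hasSum_exp (m x * z : ℂ)).mul_left
      (Complex.exp (-m x))
    rw [← Complex.exp_eq_exp_ℂ, ← Complex.exp_add] at h2
    have h3 : (fun k : ℕ => ((exp (-m x) * m x ^ k : ℝ) : ℂ) * (z ^ k / (k.factorial : ℂ)))
        = fun k : ℕ => Complex.exp (-m x) * ((m x * z) ^ k / (k.factorial : ℂ)) := by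
      funext k; push_cast; rw [mul_pow]; ring
    simp only
    rw [h3, h2.tsum_eq]
    congr 1
    simp only [z]; ring
  · refine (Real.summable_pow_div_factorial (M * ‖z‖)).of_nonneg_of_le
      (fun k => by positivity) fun k => ?_
    have := integral_mono_ae (hint k).norm
      (integrable_const ((M * ‖z‖) ^ k / (k.factorial : ℝ))) (hμ.mono fun x hx => ?_)
    · simpa using this
    · have h1 := hm.weight_le k hx
      have h2 : 0 ≤ exp (-m x) * m x ^ k := by
        have := hm.pos.le.trans (hm.lower x hx)
        positivity
      simp only
      rw [norm_mul, Complex.norm_real, norm_of_nonneg h2, norm_div, norm_pow, Complex.norm_natCast,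
        mul_pow, mul_div_assoc]
      gcongr

theorem map_eq_of_mixedWeight_eq [IsProbabilityMeasure μ] [IsProbabilityMeasure ν]
    (hm : IsIntensity m A l M) (hμ : ∀ᵐ x ∂μ, x ∈ Icc 0 A) (hν : ∀ᵐ x ∂ν, x ∈ Icc 0 A)
    (h : mixedWeight m μ = mixedWeight m ν) : μ.map m = ν.map m := by
  have hmeas := hm.continuous.measurable
  refine Measure.ext_of_charFun (funext fun t => ?_)
  rw [charFun_apply_real, charFun_apply_real, integral_map hmeas.aemeasurable (by fun_prop),
    integral_map hmeas.aemeasurable (by fun_prop), hm.integral_cexp_eq_tsum hμ,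
    hm.integral_cexp_eq_tsum hν, h]

end IsIntensity

theorem eq_of_map_affine_eq {a b : ℝ} (ha : a ≠ 0)
    (h : μ.map (fun x => a * x + b) = ν.map (fun x => a * x + b)) : μ = ν := by
  have key : ∀ ρ : Measure ℝ, (ρ.map (fun x => a * x + b)).map (fun y => (y - b) / a) = ρ := by
    intro ρ
    rw [Measure.map_map (by fun_prop) (by fun_prop)]
    convert! Measure.map_id
    funext x
    simp [ha]
  rw [← key μ, h, key ν]

end PoissonWiretap

namespace PoissonWiretap

open Real Set Filter Topology

/-! ### The mutual information of a Poisson channel -/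

variable {m : ℝ → ℝ} {A l M : ℝ} {μ ν : Measure ℝ} {κ : Kernel ℝ ℕ}

theorem ae_mem_Icc_of_measure_eq_one [IsProbabilityMeasure μ] (h : μ (Icc 0 A) = 1) :
    ∀ᵐ x ∂μ, x ∈ Icc 0 A := by
  have := (prob_compl_eq_zero_iff (μ := μ) measurableSet_Icc).2 h
  exact measure_eq_zero_iff_ae_notMem.1 this |>.mono fun x hx => not_not.1 hx

namespace IsIntensity

theorem kernel_singleton (hm : IsIntensity m A l M)
    (hκ : ∀ x, κ x = poissonMeasure (Real.toNNReal (m x))) {x : ℝ} (hx : x ∈ Icc 0 A) (k : ℕ) :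
    κ x {k} = ENNReal.ofReal (exp (-m x) * m x ^ k / (k.factorial : ℝ)) := by
  rw [hκ, poissonMeasure_singleton, Real.coe_toNNReal _ (hm.pos.le.trans (hm.lower x hx))]

theorem comp_singleton [IsProbabilityMeasure μ] (hm : IsIntensity m A l M)
    (hκ : ∀ x, κ x = poissonMeasure (Real.toNNReal (m x)))
    (hμ : ∀ᵐ x ∂μ, x ∈ Icc 0 A) (k : ℕ) :
    (κ ∘ₘ μ) {k} = ENNReal.ofReal (mixedWeight m μ k / (k.factorial : ℝ)) := by
  rw [Measure.bind_apply (MeasurableSet.of_discrete) κ.aemeasurable, mixedWeight, ← integral_div,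
    ofReal_integral_eq_lintegral_ofReal ((hm.integrable_weight hμ k).div_const _)]
  · exact lintegral_congr_ae (hμ.mono fun x hx => hm.kernel_singleton hκ hx k)
  · filter_upwards [hμ] with x hx
    have := hm.pos.le.trans (hm.lower x hx)
    simp only [Pi.zero_apply]
    positivity

theorem measurable_likelihood (hm : IsIntensity m A l M) (μ : Measure ℝ) :
    Measurable fun z : ℝ × ℕ => exp (-m z.1) * m z.1 ^ z.2 / mixedWeight m μ z.2 := by
  have h1 := hm.continuous.measurable
  have h2 : Measurable (mixedWeight m μ) := measurable_of_countable _
  have h3 : Measurable fun z : ℝ × ℕ => m z.1 := h1.comp measurable_fst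
  exact (h3.neg.exp.mul (h3.pow measurable_snd)).div (h2.comp measurable_snd)

/-- The density is the ratio of the Poisson mass to the mixture mass, with `k!` cancelled; it
suffices to compare atoms on each fibre. -/
theorem compProd_eq_withDensity [IsProbabilityMeasure μ] [IsMarkovKernel κ]
    (hm : IsIntensity m A l M) (hκ : ∀ x, κ x = poissonMeasure (Real.toNNReal (m x)))
    (hμ : ∀ᵐ x ∂μ, x ∈ Icc 0 A) :
    μ ⊗ₘ κ = (μ.prod (κ ∘ₘ μ)).withDensity fun z =>
      ENNReal.ofReal (exp (-m z.1) * m z.1 ^ z.2 / mixedWeight m μ z.2) := by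
  have hd := (hm.measurable_likelihood μ).ennreal_ofReal
  ext s hs
  rw [Measure.compProd_apply hs, withDensity_apply _ hs, ← lintegral_indicator hs,
    lintegral_prod _ (hd.indicator hs).aemeasurable]
  refine lintegral_congr_ae (hμ.mono fun x hx => ?_)
  simp only
  rw [lintegral_countable', ← Measure.tsum_indicator_apply_singleton _ _ (.of_discrete)]
  refine tsum_congr fun k => ?_
  rw [hm.comp_singleton hκ hμ]
  by_cases hk : (x, k) ∈ s
  · rw [indicator_of_mem (show k ∈ Prod.mk x ⁻¹' s from hk), indicator_of_mem hk,
      hm.kernel_singleton hκ hx, ← ENNReal.ofReal_mul]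
    · have := (hm.mixedWeight_pos hμ k).ne'
      congr 1
      simp only
      field_simp
    · have := hm.pos.le.trans (hm.lower x hx)
      have := hm.mixedWeight_pos hμ k
      simp only
      positivity
  · rw [indicator_of_notMem (show k ∉ Prod.mk x ⁻¹' s from hk), indicator_of_notMem hk, zero_mul]

theorem log_likelihood [IsProbabilityMeasure μ] (hm : IsIntensity m A l M)
    (hμ : ∀ᵐ x ∂μ, x ∈ Icc 0 A) {x : ℝ} (hx : x ∈ Icc 0 A) (k : ℕ) :
    log (exp (-m x) * m x ^ k / mixedWeight m μ k)
      = -m x + k * log (m x) - log (mixedWeight m μ k) := by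
  have h1 := hm.pos.trans_le (hm.lower x hx)
  rw [log_div (by positivity) (hm.mixedWeight_pos hμ k).ne', log_mul (by positivity) (by positivity),
    log_exp, log_pow]

theorem abs_log_likelihood_le [IsProbabilityMeasure μ] (hm : IsIntensity m A l M)
    (hμ : ∀ᵐ x ∂μ, x ∈ Icc 0 A) :
    ∃ C, ∀ x ∈ Icc 0 A, ∀ k : ℕ,
      |log (exp (-m x) * m x ^ k / mixedWeight m μ k)| ≤ C * 2 ^ k := by
  refine ⟨M + (|log l| + |log M|) + (M + |log l| + |log M|), fun x hx k => ?_⟩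
  rw [hm.log_likelihood hμ hx]
  have h1 := hm.lower x hx
  have h2 := hm.upper x hx
  have h3 := hm.pos
  have h4 := h3.trans_le h1
  have hk : (k : ℝ) ≤ 2 ^ k := by exact_mod_cast Nat.lt_two_pow_self.le
  have hk1 : (1 : ℝ) ≤ 2 ^ k := one_le_pow₀ (by norm_num)
  have b1 : |m x| ≤ M * 2 ^ k := by
    rw [abs_of_pos h4]
    exact h2.trans (le_mul_of_one_le_right (by linarith) hk1)
  have b2 : |log (m x)| ≤ |log l| + |log M| := by
    have c1 := log_le_log h3 h1
    have c2 := log_le_log h4 h2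
    rw [abs_le]
    constructor
    · linarith [neg_abs_le (log l), abs_nonneg (log M)]
    · linarith [le_abs_self (log M), abs_nonneg (log l)]
  have b3 : |k * log (m x)| ≤ (|log l| + |log M|) * 2 ^ k := by
    rw [abs_mul, Nat.abs_cast, mul_comm]
    gcongr
  have b4 := hm.abs_log_mixedWeight_le hμ k
  calc |-m x + k * log (m x) - log (mixedWeight m μ k)|
      ≤ |m x| + |k * log (m x)| + |log (mixedWeight m μ k)| := by
        refine (abs_sub _ _).trans (add_le_add_left ((abs_add_le _ _).trans ?_) _)
        rw [abs_neg]
    _ ≤ _ := by linarith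

theorem integral_log_likelihood [IsProbabilityMeasure μ] (hm : IsIntensity m A l M)
    (hκ : ∀ x, κ x = poissonMeasure (Real.toNNReal (m x))) (hμ : ∀ᵐ x ∂μ, x ∈ Icc 0 A)
    {x : ℝ} (hx : x ∈ Icc 0 A) :
    ∫ k, log (exp (-m x) * m x ^ k / mixedWeight m μ k) ∂(κ x) = infoDensity m μ x := by
  have h0 := hm.pos.le.trans (hm.lower x hx)
  rw [hκ, integral_poissonMeasure, Real.coe_toNNReal _ h0]
  have h1 := ((((hasSum_poisson_one (m x)).mul_right (-m x)).add
    ((hasSum_poisson_id (m x)).mul_right (log (m x)))).sub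
    (summable_poissonAverage (hm.abs_log_mixedWeight_le hμ) h0).hasSum).tsum_eq
  rw [infoDensity, poissonAverage]
  trans
  · refine Eq.trans (tsum_congr fun k => ?_) h1
    rw [hm.log_likelihood hμ hx, smul_eq_mul]
    ring
  · ring

theorem integrable_log_likelihood [IsProbabilityMeasure μ] [IsMarkovKernel κ]
    (hm : IsIntensity m A l M) (hκ : ∀ x, κ x = poissonMeasure (Real.toNNReal (m x)))
    (hμ : ∀ᵐ x ∂μ, x ∈ Icc 0 A) :
    Integrable (fun z : ℝ × ℕ => log (exp (-m z.1) * m z.1 ^ z.2 / mixedWeight m μ z.2))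
      (μ ⊗ₘ κ) := by
  obtain ⟨C, hC⟩ := hm.abs_log_likelihood_le hμ
  have hmeas := (hm.measurable_likelihood μ).log
  rw [Measure.integrable_compProd_iff hmeas.aestronglyMeasurable]
  have hs : ∀ x ∈ Icc 0 A, Summable fun k : ℕ => exp (-m x) * m x ^ k / (k.factorial : ℝ)
      * |log (exp (-m x) * m x ^ k / mixedWeight m μ k)| := fun x hx =>
    summable_poissonAverage (C := C) (fun k => by rw [abs_abs]; exact hC x hx k)
      (hm.pos.le.trans (hm.lower x hx))
  refine ⟨hμ.mono fun x hx => ?_, ?_⟩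
  · rw [hκ, integrable_poissonMeasure_iff, Real.coe_toNNReal _ (hm.pos.le.trans (hm.lower x hx))]
    exact hs x hx
  · refine Integrable.mono' (integrable_const (∑' k : ℕ, M ^ k / (k.factorial : ℝ) * (C * 2 ^ k)))
      hmeas.norm.stronglyMeasurable.integral_kernel_prod_right'.aestronglyMeasurable ?_
    refine hμ.mono fun x hx => ?_
    have h0 := hm.pos.le.trans (hm.lower x hx)
    rw [norm_of_nonneg (integral_nonneg fun _ => norm_nonneg _), hκ, integral_poissonMeasure,
      Real.coe_toNNReal _ h0]
    refine (hs x hx).tsum_le_tsum (fun k => ?_) (summable_two_pow_bound M C)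
    exact (le_abs_self _).trans (norm_poisson_term_le
      (f := fun k => |log (exp (-m x) * m x ^ k / mixedWeight m μ k)|)
      (fun k => by rw [abs_abs]; exact hC x hx k) h0 (hm.upper x hx) k)

/-- Disintegrating the integrable log-likelihood ratio gives the mean of `infoDensity`, which is
`infoRate` by the compensation identity with `ν = μ`. -/
theorem mutualInfo_ne_top_and_toReal [IsProbabilityMeasure μ] [IsMarkovKernel κ]
    (hm : IsIntensity m A l M) (hκ : ∀ x, κ x = poissonMeasure (Real.toNNReal (m x)))
    (hμ : ∀ᵐ x ∂μ, x ∈ Icc 0 A) :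
    mutualInfo μ κ ≠ ∞ ∧ (mutualInfo μ κ).toReal = infoRate m μ := by
  have hdens := hm.compProd_eq_withDensity hκ hμ
  have hac : μ ⊗ₘ κ ≪ μ.prod (κ ∘ₘ μ) := by
    rw [hdens]; exact withDensity_absolutelyContinuous _ _
  have hpos : ∀ᵐ z ∂(μ ⊗ₘ κ), z.1 ∈ Icc 0 A := by
    have : MeasurableSet {z : ℝ × ℕ | z.1 ∈ Icc 0 A} := measurable_fst measurableSet_Icc
    rw [Measure.ae_compProd_iff this]
    exact hμ.mono fun x hx => .of_forall fun _ => hx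
  have hllr : llr (μ ⊗ₘ κ) (μ.prod (κ ∘ₘ μ)) =ᵐ[μ ⊗ₘ κ]
      fun z => log (exp (-m z.1) * m z.1 ^ z.2 / mixedWeight m μ z.2) := by
    have h1 : (μ ⊗ₘ κ).rnDeriv (μ.prod (κ ∘ₘ μ)) =ᵐ[μ.prod (κ ∘ₘ μ)]
        fun z => ENNReal.ofReal (exp (-m z.1) * m z.1 ^ z.2 / mixedWeight m μ z.2) := by
      conv_lhs => rw [hdens]
      exact Measure.rnDeriv_withDensity _ (hm.measurable_likelihood μ).ennreal_ofReal
    filter_upwards [hac.ae_le h1, hpos] with z hz hz1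
    have h2 := hm.pos.le.trans (hm.lower _ hz1)
    have h3 := hm.mixedWeight_pos hμ z.2
    rw [llr, hz, ENNReal.toReal_ofReal (by positivity)]
  have hint := hm.integrable_log_likelihood hκ hμ
  have hint' : Integrable (llr (μ ⊗ₘ κ) (μ.prod (κ ∘ₘ μ))) (μ ⊗ₘ κ) :=
    (integrable_congr hllr).2 hint
  refine ⟨klDiv_ne_top hac hint', ?_⟩
  rw [mutualInfo, toReal_klDiv_of_measure_eq hac (by simp), integral_congr_ae hllr,
    Measure.integral_compProd hint, hm.infoRate_eq hμ hμ, mixedRelEntropy_self, sub_zero]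
  exact integral_congr_ae (hμ.mono fun x hx => hm.integral_log_likelihood hκ hμ hx)

end IsIntensity

end PoissonWiretap

namespace PoissonWiretap

open Real Set Filter Topology

/-! ### Compactness and continuity -/

variable {m : ℝ → ℝ} {A E l M : ℝ}

/-- Prokhorov's criterion in its simplest case: no mass outside one fixed compact set. -/
theorem isCompact_measure_Icc_eq_one (A : ℝ) :
    IsCompact {μ : ProbabilityMeasure ℝ | (μ : Measure ℝ) (Icc 0 A) = 1} := by
  have h := isCompact_setOfPred_probabilityMeasure_mass_eq_compl_isCompact_le (E := ℝ)
    (u := fun _ => 0) (K := fun _ => Icc 0 A) tendsto_const_nhds (fun _ => isCompact_Icc)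
    (Or.inr monotone_const)
  convert! h using 1
  ext μ
  simp only [mem_ofPred_eq, nonpos_iff_eq_zero, forall_const]
  rw [← prob_compl_eq_zero_iff measurableSet_Icc, ← ENNReal.coe_eq_zero,
    ProbabilityMeasure.ennreal_coeFn_eq_coeFn_toMeasure]

theorem continuousOn_integral (hA : 0 ≤ A) {φ : ℝ → ℝ} (hφ : ContinuousOn φ (Icc 0 A)) :
    ContinuousOn (fun μ : ProbabilityMeasure ℝ => ∫ x, φ x ∂(μ : Measure ℝ))
      {μ | (μ : Measure ℝ) (Icc 0 A) = 1} := by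
  -- Clamping to `[0, A]` gives a bounded continuous test function on all of `ℝ` without changing
  -- the integrals at hand.
  have hc : Continuous fun x => φ (projIcc 0 A hA x) :=
    (continuousOn_iff_continuous_domRestrict.1 hφ).comp continuous_projIcc
  obtain ⟨C, hC⟩ := isCompact_Icc.exists_bound_of_continuousOn hφ
  let g : BoundedContinuousFunction ℝ ℝ :=
    BoundedContinuousFunction.ofNormedAddCommGroup _ hc C fun x => hC _ (projIcc 0 A hA x).2
  have hg : Continuous fun μ : ProbabilityMeasure ℝ => ∫ x, g x ∂(μ : Measure ℝ) :=
    continuous_iff_continuousAt.2 fun μ =>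
      ProbabilityMeasure.tendsto_iff_forall_integral_tendsto.1 tendsto_id g
  refine hg.continuousOn.congr fun μ hμ => integral_congr_ae ?_
  filter_upwards [ae_mem_Icc_of_measure_eq_one hμ] with x hx
  simp [g, projIcc_of_mem hA hx]

theorem isCompact_feasible (hA : 0 ≤ A) (E : ℝ) : IsCompact (feasible A E) := by
  have h1 := isCompact_measure_Icc_eq_one A
  exact h1.of_isClosed_subset
    ((continuousOn_integral hA continuousOn_id).preimage_isClosed_of_isClosed h1.isClosed
      (isClosed_Iic (a := E))) inter_subset_left

/-- Each weight is weakly continuous in `μ`, and the series obeys a Weierstrass bound independent of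
`μ`. -/
theorem IsIntensity.continuousOn_infoRate (hm : IsIntensity m A l M) (hA : 0 ≤ A) :
    ContinuousOn (fun μ : ProbabilityMeasure ℝ => infoRate m μ)
      {μ | (μ : Measure ℝ) (Icc 0 A) = 1} := by
  have hc := hm.continuous
  refine (continuousOn_integral hA hm.continuous_mul_log_sub.continuousOn).sub ?_
  refine continuousOn_tsum (fun k => ?_)
    (summable_two_pow_bound M (M + |log l| + |log M|)) fun k μ hμ => ?_
  · have hw : ContinuousOn (fun μ : ProbabilityMeasure ℝ => mixedWeight m (μ : Measure ℝ) k)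
        {μ | (μ : Measure ℝ) (Icc 0 A) = 1} := continuousOn_integral hA (by fun_prop)
    have := (Real.continuous_mul_log.comp_continuousOn hw).div_const (k.factorial : ℝ)
    refine this.congr fun μ _ => ?_
    simp only [Function.comp]
    ring
  · have hμ' := ae_mem_Icc_of_measure_eq_one hμ
    have h1 := hm.mixedWeight_pos hμ' k
    rw [norm_mul, norm_of_nonneg (by positivity), norm_eq_abs]
    have h2 := hm.mixedWeight_le hμ' k
    exact mul_le_mul (by gcongr) (hm.abs_log_mixedWeight_le hμ' k) (abs_nonneg _)
      (div_nonneg (h1.le.trans h2) (by positivity))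

end PoissonWiretap

namespace PoissonWiretap

open Real Set Filter Topology

/-! ### Perturbations of an optimal input law -/

variable {m : ℝ → ℝ} {A E l M l' M' p δ : ℝ} {μ ν : Measure ℝ}

/-- The density `1 + t h` turns `μ` into another probability measure on `[0, A]`. -/
theorem exists_tilted [IsProbabilityMeasure μ] (hμ : ∀ᵐ x ∂μ, x ∈ Icc 0 A) {h : ℝ → ℝ} {H t : ℝ}
    (hc : Continuous h) (hH : ∀ x, |h x| ≤ H) (h0 : ∫ x, h x ∂μ = 0) (ht : |t| * H ≤ 1) :
    ∃ ν : ProbabilityMeasure ℝ, (∀ᵐ x ∂(ν : Measure ℝ), x ∈ Icc 0 A) ∧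
      ∀ φ : ℝ → ℝ, ContinuousOn φ (Icc 0 A) →
        ∫ x, φ x ∂(ν : Measure ℝ) = ∫ x, φ x ∂μ + t * ∫ x, h x * φ x ∂μ := by
  have hpos : ∀ x, 0 ≤ 1 + t * h x := fun x => by
    have h1 : |t * h x| ≤ 1 := by
      rw [abs_mul]
      exact (mul_le_mul_of_nonneg_left (hH x) (abs_nonneg t)).trans ht
    linarith [neg_abs_le (t * h x)]
  have hcont : Continuous fun x => 1 + t * h x := by fun_prop
  have hint : Integrable (fun x => 1 + t * h x) μ :=
    integrable_of_continuousOn_Icc hμ hcont.continuousOn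
  set ν : Measure ℝ := μ.withDensity fun x => ENNReal.ofReal (1 + t * h x)
  have hν : IsProbabilityMeasure ν := by
    refine ⟨?_⟩
    rw [withDensity_apply _ .univ, setLIntegral_univ,
      ← ofReal_integral_eq_lintegral_ofReal hint (.of_forall hpos), integral_add (integrable_const _)
        ((integrable_of_continuousOn_Icc hμ hc.continuousOn).const_mul t), integral_const_mul, h0]
    simp
  refine ⟨⟨ν, hν⟩, (withDensity_absolutelyContinuous _ _).ae_le hμ, fun φ hφ => ?_⟩
  have h1 := integral_withDensity_eq_integral_toReal_smul (μ := μ)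
    hcont.measurable.ennreal_ofReal (.of_forall fun _ => ENNReal.ofReal_lt_top) φ
  have h2 : ∀ x, (ENNReal.ofReal (1 + t * h x)).toReal • φ x = φ x + t * (h x * φ x) := fun x => by
    rw [ENNReal.toReal_ofReal (hpos x), smul_eq_mul]; ring
  simp only [h2] at h1
  have h3 : Integrable (fun x => h x * φ x) μ :=
    integrable_of_continuousOn_Icc hμ (hc.continuousOn.mul hφ)
  rw [ProbabilityMeasure.coe_mk, h1, integral_add (integrable_of_continuousOn_Icc hμ hφ)
    (h3.const_mul t), integral_const_mul]

/-- A function orthogonal to everything orthogonal to the affine functions is affine. -/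
theorem exists_affine_of_orthogonal [IsProbabilityMeasure μ] (hA : 0 ≤ A)
    (hμ : ∀ᵐ x ∂μ, x ∈ Icc 0 A) {c : ℝ → ℝ} (hc : Continuous c)
    (horth : ∀ h : ℝ → ℝ, Continuous h → (∃ H, ∀ x, |h x| ≤ H) → ∫ x, h x ∂μ = 0 →
      ∫ x, h x * x ∂μ = 0 → ∫ x, h x * c x ∂μ = 0) :
    ∃ a b : ℝ, ∀ᵐ x ∂μ, c x = a + b * x := by
  have hI : ∀ {φ : ℝ → ℝ}, Continuous φ → Integrable φ μ := fun hφ =>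
    integrable_of_continuousOn_Icc hμ hφ.continuousOn
  set x₀ := ∫ x, x ∂μ
  set c₀ := ∫ x, c x ∂μ
  have hx0 : ∫ x, (x - x₀) ∂μ = 0 := by
    rw [integral_sub (hI continuous_id') (integrable_const _)]; simp [x₀]
  set V := ∫ x, (x - x₀) * (x - x₀) ∂μ
  -- `β` is the regression slope of `c` on `x`. If the variance `V` is zero, then `x = x₀` almost
  -- everywhere and slope `0` serves.
  obtain ⟨β, hβ⟩ : ∃ β : ℝ, ∫ x, (x - x₀) * c x ∂μ = β * V := by
    by_cases hV : V = 0
    · refine ⟨0, ?_⟩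
      have h1 := (integral_eq_zero_iff_of_nonneg (fun x => mul_self_nonneg (x - x₀))
        (hI (by fun_prop))).1 hV
      rw [zero_mul]
      refine integral_eq_zero_of_ae (h1.mono fun x hx => ?_)
      have : x - x₀ = 0 := mul_self_eq_zero.1 hx
      simp [this]
    · exact ⟨_, (div_mul_cancel₀ _ hV).symm⟩
  -- The residual of the `L²` projection of `c` onto the affine functions; `h` is its clamped,
  -- bounded version. The hypothesis makes `g` orthogonal to `c`, hence to itself.
  set g : ℝ → ℝ := fun x => c x - c₀ - β * (x - x₀)
  have hg : Continuous g := by fun_prop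
  set h : ℝ → ℝ := fun x => g (projIcc 0 A hA x)
  have hh : Continuous h := by
    have := (continuous_projIcc (h := hA)).subtype_val
    exact hg.comp this
  have hgh : h =ᵐ[μ] g := hμ.mono fun x hx => by simp only [h]; rw [projIcc_of_mem hA hx]
  obtain ⟨H, hH⟩ := isCompact_Icc.exists_bound_of_continuousOn (hg.continuousOn (s := Icc 0 A))
  have e0 : ∫ x, g x ∂μ = 0 := by
    simp only [g]
    rw [integral_sub (hI (by fun_prop)) (hI (by fun_prop)), integral_const_mul, hx0,
      integral_sub (hI hc) (integrable_const _)]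
    simp [c₀]
  have e1 : ∫ x, g x * (x - x₀) ∂μ = 0 := by
    have : ∀ x, g x * (x - x₀) = (x - x₀) * c x - c₀ * (x - x₀) - β * ((x - x₀) * (x - x₀)) :=
      fun x => by simp only [g]; ring
    simp only [this]
    rw [integral_sub (hI (by fun_prop)) (hI (by fun_prop)),
      integral_sub (hI (by fun_prop)) (hI (by fun_prop)), integral_const_mul, integral_const_mul,
      hx0, hβ]
    ring
  have e2 : ∫ x, g x * x ∂μ = 0 := by
    have : ∀ x, g x * x = g x * (x - x₀) + x₀ * g x := fun x => by ring
    simp only [this]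
    rw [integral_add (hI (by fun_prop)) (hI (by fun_prop)), integral_const_mul, e0, e1]
    ring
  have e3 : ∫ x, g x * c x ∂μ = 0 := by
    rw [← horth h hh ⟨H, fun x => hH _ (projIcc 0 A hA x).2⟩ ((integral_congr_ae hgh).trans e0)
      ((integral_congr_ae (hgh.mul (ae_eq_refl _))).trans e2)]
    exact (integral_congr_ae (hgh.mul (ae_eq_refl _))).symm
  have e4 : ∫ x, g x * g x ∂μ = 0 := by
    have : ∀ x, g x * g x = g x * c x - c₀ * g x - β * (g x * (x - x₀)) :=
      fun x => by simp only [g]; ring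
    simp only [this]
    rw [integral_sub (hI (by fun_prop)) (hI (by fun_prop)),
      integral_sub (hI (by fun_prop)) (hI (by fun_prop)), integral_const_mul, integral_const_mul,
      e0, e1, e3]
    ring
  have h1 := (integral_eq_zero_iff_of_nonneg (fun x => mul_self_nonneg (g x))
    (hI (by fun_prop))).1 e4
  refine ⟨c₀ - β * x₀, β, h1.mono fun x hx => ?_⟩
  have : c x - c₀ - β * (x - x₀) = 0 := mul_self_eq_zero.1 hx
  linarith

/-- The secrecy rate of the pair of intensities `m` and `p m + δ`. -/
noncomputable def degradedRate (m : ℝ → ℝ) (p δ : ℝ) (μ : Measure ℝ) : ℝ :=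
  infoRate m μ - infoRate (fun x => p * m x + δ) μ

/-- The density whose mean is the secrecy rate. -/
noncomputable def degradedDensity (m : ℝ → ℝ) (p δ : ℝ) (μ : Measure ℝ) (x : ℝ) : ℝ :=
  infoDensity m μ x - infoDensity (fun x => p * m x + δ) μ x

theorem continuous_degradedDensity [IsProbabilityMeasure μ] (hm : IsIntensity m A l M)
    (hm' : IsIntensity (fun x => p * m x + δ) A l' M') (hμ : ∀ᵐ x ∂μ, x ∈ Icc 0 A) :
    Continuous (degradedDensity m p δ μ) :=
  (hm.continuous_infoDensity hμ).sub (hm'.continuous_infoDensity hμ)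

theorem degradedRate_eq [IsProbabilityMeasure μ] [IsProbabilityMeasure ν]
    (hm : IsIntensity m A l M) (hm' : IsIntensity (fun x => p * m x + δ) A l' M')
    (hμ : ∀ᵐ x ∂μ, x ∈ Icc 0 A) (hν : ∀ᵐ x ∂ν, x ∈ Icc 0 A) :
    degradedRate m p δ ν = ∫ x, degradedDensity m p δ μ x ∂ν
      - (mixedRelEntropy m ν μ - mixedRelEntropy (fun x => p * m x + δ) ν μ) := by
  rw [degradedRate, hm.infoRate_eq hμ hν, hm'.infoRate_eq hμ hν]
  simp only [degradedDensity]
  rw [integral_sub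
    (integrable_of_continuousOn_Icc hν (hm.continuous_infoDensity hμ).continuousOn)
    (integrable_of_continuousOn_Icc hν (hm'.continuous_infoDensity hμ).continuousOn)]
  ring

theorem mem_feasible_of_ae {μ : ProbabilityMeasure ℝ} (h : ∀ᵐ x ∂(μ : Measure ℝ), x ∈ Icc 0 A)
    (hE : ∫ x, x ∂(μ : Measure ℝ) ≤ E) : μ ∈ feasible A E :=
  ⟨(prob_compl_eq_zero_iff measurableSet_Icc).1 h, hE⟩

theorem integral_mul_degradedDensity_eq_zero {μ : ProbabilityMeasure ℝ}
    (hm : IsIntensity m A l M) (hm' : IsIntensity (fun x => p * m x + δ) A l' M')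
    (hμ : μ ∈ feasible A E)
    (hmax : ∀ ν ∈ feasible A E, degradedRate m p δ (ν : Measure ℝ)
      ≤ degradedRate m p δ (μ : Measure ℝ))
    {h : ℝ → ℝ} {H : ℝ} (hc : Continuous h) (hH : ∀ x, |h x| ≤ H)
    (h0 : ∫ x, h x ∂(μ : Measure ℝ) = 0) (h1 : ∫ x, h x * x ∂(μ : Measure ℝ) = 0) :
    ∫ x, h x * degradedDensity m p δ μ x ∂(μ : Measure ℝ) = 0 := by
  have hμ' := ae_mem_Icc_of_measure_eq_one hμ.1
  have hH0 : 0 ≤ H := (abs_nonneg _).trans (hH 0)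
  set I := ∫ x, h x * degradedDensity m p δ μ x ∂(μ : Measure ℝ)
  -- Optimality gives `t * I ≤ D_B - D_E ≤ D_B ≤ (|t| * H) ^ 2`. Since `h` is orthogonal to `x`, the
  -- mean is unchanged and both signs of `t` are feasible.
  have key : ∀ t : ℝ, |t| * H ≤ 1 → t * I ≤ t ^ 2 * H ^ 2 := by
    intro t ht
    obtain ⟨ν, hν, hint⟩ := exists_tilted hμ' hc hH h0 ht
    have hfeas : ν ∈ feasible A E := mem_feasible_of_ae hν <| by
      rw [hint _ (continuousOn_id' _), h1, mul_zero, add_zero]; exact hμ.2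
    have hle := hmax ν hfeas
    rw [degradedRate_eq hm hm' hμ' hν, degradedRate_eq hm hm' hμ' hμ',
      IsIntensity.mixedRelEntropy_self, IsIntensity.mixedRelEntropy_self,
      hint _ (continuous_degradedDensity hm hm' hμ').continuousOn] at hle
    have hnn := hm'.mixedRelEntropy_nonneg hμ' hν
    have hsq := hm.mixedRelEntropy_le_sq hμ' hν (ε := |t| * H) fun k => by
      have hcm := hm.continuous
      have hw : Continuous fun x => exp (-m x) * m x ^ k := by fun_prop
      rw [mixedWeight, hint _ hw.continuousOn, mixedWeight, add_sub_cancel_left, abs_mul, mul_assoc]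
      gcongr
      rw [← integral_const_mul]
      refine (abs_integral_le_integral_abs).trans (integral_mono_ae
        (integrable_of_continuousOn_Icc hμ' (hc.mul hw).abs.continuousOn)
        (integrable_of_continuousOn_Icc hμ' (hw.const_mul H).continuousOn)
        (hμ'.mono fun x hx => ?_))
      have := hm.pos.le.trans (hm.lower x hx)
      simp only
      rw [abs_mul, abs_of_nonneg (by positivity : 0 ≤ exp (-m x) * m x ^ k)]
      gcongr
      exact hH x
    rw [mul_pow, sq_abs] at hsq
    linarith
  by_contra hI
  have hIpos : 0 < |I| := abs_pos.2 hI
  -- The first bound keeps the tilted density nonnegative; the second makes the quadratic term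
  -- smaller than the linear one.
  set s := min (1 / (H + 1)) (|I| / (2 * (H ^ 2 + 1)))
  have hs : 0 < s := by positivity
  have hs1 : s * H ≤ 1 := by
    calc s * H ≤ 1 / (H + 1) * H := by gcongr; exact min_le_left _ _
      _ ≤ 1 := by rw [div_mul_eq_mul_div, div_le_one (by positivity)]; linarith
  have hs2 : s * H ^ 2 < |I| := by
    calc s * H ^ 2 ≤ |I| / (2 * (H ^ 2 + 1)) * H ^ 2 := by gcongr; exact min_le_right _ _
      _ < |I| := by
        rw [div_mul_eq_mul_div, div_lt_iff₀ (by positivity)]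
        nlinarith [sq_nonneg H]
  have hle : s * |I| ≤ s * (s * H ^ 2) := by
    rcases abs_cases I with ⟨e, _⟩ | ⟨e, _⟩
    · have := key s (by rwa [abs_of_pos hs])
      rw [e]; linarith
    · have := key (-s) (by rwa [abs_neg, abs_of_pos hs])
      rw [e]; linarith
  exact absurd (le_of_mul_le_mul_left hle hs) (not_le.2 hs2)

/-- Strict concavity: two optimal input laws have the same output law. -/
theorem mixedWeight_eq_of_optimal {μ ν : ProbabilityMeasure ℝ} {R : ℝ}
    (hm : IsIntensity m A l M) (hm' : IsIntensity (fun x => p * m x + δ) A l' M')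
    (hp0 : 0 < p) (hp1 : p ≤ 1) (hδ : 0 ≤ δ) (hpδ : p < 1 ∨ 0 < δ)
    (hμ : μ ∈ feasible A E) (hν : ν ∈ feasible A E)
    (hmax : ∀ ρ ∈ feasible A E, degradedRate m p δ (ρ : Measure ℝ) ≤ R)
    (hμR : degradedRate m p δ (μ : Measure ℝ) = R)
    (hνR : degradedRate m p δ (ν : Measure ℝ) = R) :
    mixedWeight m (μ : Measure ℝ) = mixedWeight m (ν : Measure ℝ) := by
  have hμ' := ae_mem_Icc_of_measure_eq_one hμ.1
  have hν' := ae_mem_Icc_of_measure_eq_one hν.1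
  set ρ : Measure ℝ := (2⁻¹ : ℝ≥0∞) • (μ : Measure ℝ) + (2⁻¹ : ℝ≥0∞) • (ν : Measure ℝ)
  have hρ : IsProbabilityMeasure ρ := ⟨by simp [ρ, ENNReal.inv_two_add_inv_two]⟩
  have hρ' : ∀ᵐ x ∂ρ, x ∈ Icc 0 A := by
    rw [ae_add_measure_iff]
    exact ⟨Measure.ae_smul_measure hμ' _, Measure.ae_smul_measure hν' _⟩
  have hint : ∀ φ : ℝ → ℝ, Continuous φ → ∫ x, φ x ∂ρ
      = (∫ x, φ x ∂(μ : Measure ℝ) + ∫ x, φ x ∂(ν : Measure ℝ)) / 2 := fun φ hφ => by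
    rw [integral_add_measure
      ((integrable_of_continuousOn_Icc hμ' hφ.continuousOn).smul_measure (by simp))
      ((integrable_of_continuousOn_Icc hν' hφ.continuousOn).smul_measure (by simp)),
      integral_smul_measure, integral_smul_measure]
    simp
    ring
  have hfeas : (⟨ρ, hρ⟩ : ProbabilityMeasure ℝ) ∈ feasible A E := mem_feasible_of_ae hρ' <| by
    rw [ProbabilityMeasure.coe_mk, hint _ continuous_id']
    linarith [hμ.2, hν.2]
  have hle := hmax _ hfeas
  rw [ProbabilityMeasure.coe_mk, degradedRate_eq hm hm' hρ' hρ', IsIntensity.mixedRelEntropy_self,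
    IsIntensity.mixedRelEntropy_self, hint _ (continuous_degradedDensity hm hm' hρ')] at hle
  rw [degradedRate_eq hm hm' hρ' hμ'] at hμR
  rw [degradedRate_eq hm hm' hρ' hν'] at hνR
  have kμ := hm.mixedRelEntropy_degraded_le hm' hρ' hμ' hp0 hp1 hδ hpδ
  have kν := hm.mixedRelEntropy_degraded_le hm' hρ' hν' hp0 hp1 hδ hpδ
  -- The midpoint rate exceeds `R` by half the sum of the two gaps relative to `ρ`, so both
  -- nonnegative gaps vanish.
  rw [kμ.2 (by linarith [kμ.1, kν.1]), kν.2 (by linarith [kμ.1, kν.1])]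

end PoissonWiretap

namespace PoissonWiretap

open Real Set Filter Topology

/-! ### Finiteness of the support -/

variable {A E l M l' M' p δ : ℝ} {μ ν : Measure ℝ}

theorem not_differentiableAt_of_eq_mul_log {ψ : ℝ → ℝ} (h : ∀ r, 0 < r → r * log r = ψ r) :
    ¬ DifferentiableAt ℝ ψ 0 := by
  intro hψ
  have hd : DifferentiableWithinAt ℝ (fun r => ψ r + 1 - r) (Ioi 0) 0 :=
    ((hψ.add_const 1).sub differentiableAt_id).differentiableWithinAt
  have heq : ∀ r ∈ Ioi (0 : ℝ), klFun r = ψ r + 1 - r := fun r hr => by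
    rw [klFun_apply, h r hr]
  -- The hypothesis is silent at `r = 0`; the values there agree because both sides have the same
  -- right limit.
  have h1 : Tendsto klFun (𝓝[>] 0) (𝓝 (klFun 0)) :=
    continuous_klFun.continuousAt.tendsto.mono_left nhdsWithin_le_nhds
  have h2 : Tendsto klFun (𝓝[>] 0) (𝓝 (ψ 0 + 1 - 0)) :=
    hd.continuousWithinAt.tendsto.congr' (eventually_nhdsWithin_of_forall fun r hr => (heq r hr).symm)
  exact not_differentiableWithinAt_klFun_Ioi_zero (hd.congr heq (tendsto_nhds_unique h1 h2))

/-- For `δ > 0` the second term is smooth at `0`; for `δ = 0` the left side is `(1 - p) * r * log r`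
plus a linear term, with `p < 1`. Either way the singularity of `r log r` survives. -/
theorem not_differentiableAt_of_eq_mul_log_sub {Q : ℝ → ℝ} (hδ : 0 ≤ δ) (hp : 0 < p)
    (hpδ : p < 1 ∨ 0 < δ)
    (h : ∀ r, 0 < r → r * log r - (p * r + δ) * log (p * r + δ) = Q r) :
    ¬ DifferentiableAt ℝ Q 0 := by
  intro hQ
  rcases hδ.eq_or_lt with rfl | hδ
  · have hp1 : 0 < 1 - p := sub_pos.2 (hpδ.resolve_right (lt_irrefl _))
    refine not_differentiableAt_of_eq_mul_log (ψ := fun r => (Q r + p * r * log p) / (1 - p))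
      (fun r hr => ?_) (by fun_prop)
    rw [← h r hr, add_zero, log_mul hp.ne' hr.ne', eq_div_iff hp1.ne']
    ring
  · refine not_differentiableAt_of_eq_mul_log
      (ψ := fun r => Q r + (p * r + δ) * log (p * r + δ)) (fun r hr => by rw [← h r hr]; ring) ?_
    have : p * 0 + δ ≠ 0 := by simpa using hδ.ne'
    fun_prop (disch := assumption)

theorem finite_of_degradedDensity_eq_affine {a b s₀ s₁ : ℝ} [IsProbabilityMeasure μ]
    (ha : 0 < a) (hb : 0 < b)
    (hm : IsIntensity (fun x => a * x + b) A l M)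
    (hm' : IsIntensity (fun x => p * (a * x + b) + δ) A l' M')
    (hp0 : 0 < p) (hδ : 0 ≤ δ) (hpδ : p < 1 ∨ 0 < δ)
    (hμ : ∀ᵐ x ∂μ, x ∈ Icc 0 A) {S : Set ℝ} (hS : S ⊆ Icc 0 A)
    (heq : ∀ x ∈ S, degradedDensity (fun x => a * x + b) p δ μ x = s₀ + s₁ * x) : S.Finite := by
  by_contra hinf
  obtain ⟨x₁, hx₁, hacc⟩ := Set.Infinite.exists_accPt_of_subset_isCompact hinf isCompact_Icc hS
  set f₁ := poissonAverage fun k => log (mixedWeight (fun x => a * x + b) μ k)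
  set f₂ := poissonAverage fun k => log (mixedWeight (fun x => p * (a * x + b) + δ) μ k)
  have hf₁ : AnalyticOnNhd ℝ f₁ univ :=
    analyticOnNhd_poissonAverage (hm.abs_log_mixedWeight_le hμ)
  have hf₂ : AnalyticOnNhd ℝ f₂ univ :=
    analyticOnNhd_poissonAverage (hm'.abs_log_mixedWeight_le hμ)
  -- In the variable `r = a * x + b`, `Q` gathers everything analytic on the whole line; only the
  -- two logarithmic terms remain apart.
  set Q : ℝ → ℝ := fun r => r + f₁ r - (p * r + δ) - f₂ (p * r + δ) + (s₀ + s₁ * ((r - b) / a))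
  have hlin : ∀ r, AnalyticAt ℝ (fun r => p * r + δ) r := fun r => by fun_prop
  have hQ : ∀ r, AnalyticAt ℝ Q r := fun r => by
    have h1 := hf₁ r (mem_univ _)
    have h2 : AnalyticAt ℝ (fun r => f₂ (p * r + δ)) r :=
      AnalyticAt.fun_comp (f := fun r => p * r + δ) (hf₂ (p * r + δ) (mem_univ _)) (hlin r)
    have h3 : AnalyticAt ℝ (fun r => s₀ + s₁ * ((r - b) / a)) r := by
      simp only [div_eq_mul_inv]; fun_prop
    exact (((analyticAt_id.add h1).sub (hlin r)).sub h2).add h3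
  set F : ℝ → ℝ := fun r => r * log r - (p * r + δ) * log (p * r + δ) - Q r
  have hF : AnalyticOnNhd ℝ F (Ioi 0) := fun r hr => by
    have hr : 0 < r := hr
    have h1 : AnalyticAt ℝ log r := analyticAt_log hr
    have h2 : AnalyticAt ℝ (fun r => log (p * r + δ)) r :=
      AnalyticAt.fun_comp (f := fun r => p * r + δ)
        (analyticAt_log (by positivity : 0 < p * r + δ)) (hlin r)
    exact ((analyticAt_id.mul h1).sub ((hlin r).mul h2)).sub (hQ r)
  have hFS : ∀ x ∈ S, F (a * x + b) = 0 := fun x hx => by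
    have h1 := heq x hx
    have h2 : (a * x + b - b) / a = x := by field_simp; ring
    simp only [degradedDensity, infoDensity] at h1
    simp only [F, Q, h2]
    linarith
  have hfreq : ∃ᶠ r in 𝓝[≠] (a * x₁ + b), F r = 0 := by
    have h1 := accPt_iff_frequently_nhdsNE.1 hacc
    have h2 : Tendsto (fun x => a * x + b) (𝓝[≠] x₁) (𝓝[≠] (a * x₁ + b)) := by
      refine tendsto_nhdsWithin_iff.2 ⟨?_, ?_⟩
      · exact (Continuous.tendsto (by fun_prop) x₁).mono_left nhdsWithin_le_nhds
      · filter_upwards [self_mem_nhdsWithin] with x hx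
        simpa [ha.ne'] using hx
    exact h2.frequently (h1.mono hFS)
  -- Because `b > 0`, the accumulation point is inside `(0, ∞)`, and the identity spreads to all `r
  -- > 0`, below the attained intensities `r ≥ b`.
  have hpos : a * x₁ + b ∈ Ioi (0 : ℝ) := by
    have := hx₁.1
    rw [mem_Ioi]; positivity
  have hzero := hF.eqOn_zero_of_preconnected_of_frequently_eq_zero isPreconnected_Ioi hpos hfreq
  exact not_differentiableAt_of_eq_mul_log_sub hδ hp0 hpδ
    (fun r hr => sub_eq_zero.1 (hzero hr)) (hQ 0).differentiableAt

theorem finite_support_of_optimal {a b : ℝ} {μ : ProbabilityMeasure ℝ} (hA : 0 ≤ A)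
    (ha : 0 < a) (hb : 0 < b)
    (hm : IsIntensity (fun x => a * x + b) A l M)
    (hm' : IsIntensity (fun x => p * (a * x + b) + δ) A l' M')
    (hp0 : 0 < p) (hδ : 0 ≤ δ) (hpδ : p < 1 ∨ 0 < δ) (hμ : μ ∈ feasible A E)
    (hmax : ∀ ν ∈ feasible A E, degradedRate (fun x => a * x + b) p δ (ν : Measure ℝ)
      ≤ degradedRate (fun x => a * x + b) p δ (μ : Measure ℝ)) :
    (μ : Measure ℝ).support.Finite := by
  have hμ' := ae_mem_Icc_of_measure_eq_one hμ.1
  have hc := continuous_degradedDensity hm hm' hμ'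
  obtain ⟨s₀, s₁, hs⟩ := exists_affine_of_orthogonal hA hμ' hc fun h hh ⟨H, hH⟩ h0 h1 =>
    integral_mul_degradedDensity_eq_zero hm hm' hμ hmax hh hH h0 h1
  -- The density is continuous, so an almost everywhere affine identity holds on a closed set of
  -- full measure, which contains the support.
  exact finite_of_degradedDensity_eq_affine ha hb hm hm' hp0 hδ hpδ hμ'
    (Measure.support_subset_of_isClosed isClosed_Icc hμ')
    (Measure.support_subset_of_isClosed (isClosed_eq hc (by fun_prop)) hs)

/-! ### The wiretap channel -/

theorem isIntensity_affine {a b : ℝ} (ha : 0 < a) (hb : 0 < b) (A : ℝ) :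
    IsIntensity (fun x => a * x + b) A b (a * A + b) where
  continuous := by fun_prop
  pos := hb
  lower x hx := by
    have := mul_nonneg ha.le hx.1
    linarith
  upper x hx := by
    have := mul_le_mul_of_nonneg_left hx.2 ha.le
    linarith

theorem dirac_zero_mem_feasible (hA : 0 ≤ A) (hE : 0 ≤ E) :
    (⟨Measure.dirac 0, inferInstance⟩ : ProbabilityMeasure ℝ) ∈ feasible A E := by
  refine mem_feasible_of_ae ?_ ?_
  · rw [ProbabilityMeasure.coe_mk, ae_dirac_eq, eventually_pure]
    exact ⟨le_rfl, hA⟩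
  · simpa using hE

end PoissonWiretap

theorem theorem1 (αB αE lamB lamE Δ A E : ℝ)
    (hαB : 0 < αB) (hαE : 0 < αE) (hlamB : 0 < lamB) (hlamE : 0 < lamE) (hΔ : 0 < Δ)
    (hA : 0 ≤ A) (hE : 0 ≤ E)
    (hdeg1 : αE ≤ αB) (hdeg2 : lamB / αB ≤ lamE / αE)
    (hstrict : αE < αB ∨ lamB / αB < lamE / αE) :
    -- both mutual informations are finite, and the supremum is that of a bounded set
    (∀ μ ∈ PoissonWiretap.feasible A E,
      PoissonWiretap.mutualInfo (μ : Measure ℝ) (PoissonWiretap.channel αB lamB Δ) ≠ ∞ ∧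
      PoissonWiretap.mutualInfo (μ : Measure ℝ) (PoissonWiretap.channel αE lamE Δ) ≠ ∞) ∧
    BddAbove (PoissonWiretap.secrecyRate (PoissonWiretap.channel αB lamB Δ)
      (PoissonWiretap.channel αE lamE Δ) '' PoissonWiretap.feasible A E) ∧
    -- there is exactly one optimal input law, and its support is finite
    ∃ μ : ProbabilityMeasure ℝ,
      (μ ∈ PoissonWiretap.feasible A E ∧
        PoissonWiretap.secrecyRate (PoissonWiretap.channel αB lamB Δ)
            (PoissonWiretap.channel αE lamE Δ) μ =
          PoissonWiretap.secrecyCapacity (PoissonWiretap.channel αB lamB Δ)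
            (PoissonWiretap.channel αE lamE Δ) A E) ∧
      (∀ ν ∈ PoissonWiretap.feasible A E,
        PoissonWiretap.secrecyRate (PoissonWiretap.channel αB lamB Δ)
            (PoissonWiretap.channel αE lamE Δ) ν =
          PoissonWiretap.secrecyCapacity (PoissonWiretap.channel αB lamB Δ)
            (PoissonWiretap.channel αE lamE Δ) A E → ν = μ) ∧
      (μ : Measure ℝ).support.Finite := by
  open PoissonWiretap Set in
  set κB := channel αB lamB Δ
  set κE := channel αE lamE Δ
  set a := αB * Δ
  set b := lamB * Δ
  set p := αE / αB
  -- The offset for which `p * (a * x + b) + δ` is the eavesdropper's mean; its sign is that of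
  -- `lamE / αE - lamB / αB`.
  set δ := lamE * Δ - p * b
  have ha : 0 < a := mul_pos hαB hΔ
  have hb : 0 < b := mul_pos hlamB hΔ
  have hp0 : 0 < p := div_pos hαE hαB
  have hp1 : p ≤ 1 := (div_le_one hαB).2 hdeg1
  have hδ_eq : δ = αE * Δ * (lamE / αE - lamB / αB) := by
    simp only [δ, p, b]; field_simp
  have hδ : 0 ≤ δ := by
    rw [hδ_eq]; exact mul_nonneg (by positivity) (sub_nonneg.2 hdeg2)
  have hpδ : p < 1 ∨ 0 < δ := hstrict.imp (fun h => (div_lt_one hαB).2 h) fun h => by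
    rw [hδ_eq]; exact mul_pos (by positivity) (sub_pos.2 h)
  have hm := isIntensity_affine ha hb A
  have hmE_eq : (fun x => p * (a * x + b) + δ) = fun x => αE * Δ * x + lamE * Δ := by
    funext x; simp only [δ, p, a]; field_simp; ring
  have hm' : IsIntensity (fun x => p * (a * x + b) + δ) A (lamE * Δ) (αE * Δ * A + lamE * Δ) := by
    rw [hmE_eq]; exact isIntensity_affine (by positivity) (by positivity) A
  have hκB : ∀ x, κB x = poissonMeasure (Real.toNNReal (a * x + b)) := fun x => by
    change poissonMeasure _ = _
    congr 2; simp only [a, b]; ring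
  have hκE : ∀ x, κE x = poissonMeasure (Real.toNNReal (p * (a * x + b) + δ)) := fun x => by
    change poissonMeasure _ = _
    congr 2; rw [congrFun hmE_eq x]; ring
  have hB : ∀ μ ∈ feasible A E, _ := fun μ hμ =>
    hm.mutualInfo_ne_top_and_toReal hκB (ae_mem_Icc_of_measure_eq_one hμ.1)
  have hE' : ∀ μ ∈ feasible A E, _ := fun μ hμ =>
    hm'.mutualInfo_ne_top_and_toReal hκE (ae_mem_Icc_of_measure_eq_one hμ.1)
  have hrate : ∀ μ ∈ feasible A E, secrecyRate κB κE μ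
      = degradedRate (fun x => a * x + b) p δ (μ : Measure ℝ) := fun μ hμ => by
    rw [secrecyRate, (hB μ hμ).2, (hE' μ hμ).2, degradedRate]
  have hcont : ContinuousOn (secrecyRate κB κE) (feasible A E) :=
    (((hm.continuousOn_infoRate hA).sub (hm'.continuousOn_infoRate hA)).mono
      inter_subset_left).congr hrate
  have hcpt := isCompact_feasible hA E
  have hbdd : BddAbove (secrecyRate κB κE '' feasible A E) :=
    (hcpt.image_of_continuousOn hcont).bddAbove
  obtain ⟨μ, hμ, hmax⟩ := hcpt.exists_isMaxOn ⟨_, dirac_zero_mem_feasible hA hE⟩ hcont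
  have hcap : secrecyCapacity κB κE A E = secrecyRate κB κE μ :=
    IsGreatest.csSup_eq ⟨mem_image_of_mem _ hμ, forall_mem_image.2 hmax⟩
  have hmax' : ∀ ν ∈ feasible A E, degradedRate (fun x => a * x + b) p δ (ν : Measure ℝ)
      ≤ degradedRate (fun x => a * x + b) p δ (μ : Measure ℝ) := fun ν hν => by
    rw [← hrate ν hν, ← hrate μ hμ]; exact hmax hν
  refine ⟨fun ν hν => ⟨(hB ν hν).1, (hE' ν hν).1⟩, hbdd, μ, ⟨hμ, hcap.symm⟩, fun ν hν hνcap => ?_,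
    finite_support_of_optimal hA ha hb hm hm' hp0 hδ hpδ hμ hmax'⟩
  have hw := mixedWeight_eq_of_optimal hm hm' hp0 hp1 hδ hpδ hν hμ hmax'
    (by rw [← hrate ν hν, ← hrate μ hμ, hνcap, hcap]) rfl
  exact Subtype.ext (eq_of_map_affine_eq ha.ne' (hm.map_eq_of_mixedWeight_eq
    (μ := (ν : Measure ℝ)) (ν := (μ : Measure ℝ)) (ae_mem_Icc_of_measure_eq_one hν.1)
    (ae_mem_Icc_of_measure_eq_one hμ.1) hw))
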